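/- Let $L>0$ and $s>0$. Let $\Lambda_L$ be the two-dimensional torus of side length $L$, identified with $(-L/2,L/2]^2$, and let $C^\infty(\Lambda_L)$ be the space of real smooth $L$-periodic functions. For $\varphi\in C^\infty(\Lambda_L)$ and $\xi\in\Lambda_L^*=\frac{2\pi}{L}\mathbb{Z}^2$ write $\widehat\varphi(\xi)=\int_{\Lambda_L}\varphi(x)e^{-i\xi\cdot x}dx$. Let $H^{-s}(\Lambda_L)$ be the dual of $H^s(\Lambda_L)$ with $\|\varphi\|_{H^s}^2=L^{-2}\sum_{\xi}(1+|\xi|^2)^s|\widehat\varphi(\xi)|^2$; write $Z.\varphi$ for the pairing of $Z\in H^{-s}(\Lambda_L)$ with $\varphi\in C^\infty(\Lambda_L)$. All probability measures are Borel. For probability measures $\nu,\mu$ on the same space, $\mathcal H(\nu|\mu)=\mathbb{E}^{\nu}[\log\frac{d\nu}{d\mu}]\in[0,\infty]$ if $\nu\ll\mu$, and $\mathcal H(\nu|\mu)=+\infty$ otherwise. (i) (Free field.) Let $m>0$, and let $\mu_{m,L}$ be the law on $H^{-s}(\Lambda_L)$ of the massive Gaussian free field, i.e. the centered Gaussian measure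 with $$\mathbb{E}^{\mu_{m,L}}[(Z.\varphi)(Z.\psi)]=\frac{1}{L^2}\sum_{\xi\in\Lambda_L^*}\frac{\widehat\varphi(\xi)\overline{\widehat\psi(\xi)}}{m^2+|\xi|^2}\qquad\text{for all }\varphi,\psi\in C^\infty(\Lambda_L).$$ For $Y\in H^{-s}(\Lambda_L)$ put $\|Y\|_{H^1_m(\Lambda_L)}^2=\|\nabla Y\|_{L^2(\Lambda_L)}^2+m^2\|Y\|_{L^2(\Lambda_L)}^2$ (with the distributional gradient; $+\infty$ if $Y$ or $\nabla Y$ is not in $L^2$). For $N\ge1$ and probability measures $\mu_1,\mu_2$ on $H^{-s}(\Lambda_L)^N$ let $$W_{H^1_m(\Lambda_L)^N}(\mu_1,\mu_2)=\inf_{\pi}\Big\{\int\frac1N\sum_{j=1}^N\|X_j-Y_j\|_{H^1_m(\Lambda_L)}^2\,d\pi(X,Y)\Big\}^{1/2}\in[0,\infty],$$ the infimum being over all couplings $\pi$ of $\mu_1$ and $\mu_2$. Then for every $N\ge 1$ and every probability measure $\rho$ on $H^{-s}(\Lambda_L)^N$, $$W_{H^1_m(\Lambda_L)^N}(\rho,\mu_{m,L}^{\otimes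 N})\le\sqrt{\tfrac{2}{N}}\;\mathcal H(\rho\,|\,\mu_{m,L}^{\otimes N})^{1/2}.$$ (ii) (General Gaussian measures.) Let $\Sigma$ be a strictly positive, self-adjoint, compact operator on $L^2(\Lambda_L)$ that admits an orthonormal basis $(e_k)_{k\in\mathbb N}$ of $L^2(\Lambda_L)$ with $e_k\in C^\infty(\Lambda_L)$ and $\Sigma e_k=\lambda_k e_k$. Let $\mu$ be a centered Gaussian probability measure on $H^{-s}(\Lambda_L)$ with $\mathbb{E}^{\mu}[(Z.\varphi)(Z.\psi)]=\langle\Sigma\varphi,\psi\rangle_{L^2(\Lambda_L)}$ for all $\varphi,\psi\in C^\infty(\Lambda_L)$. For $\Phi\in H^{-s}(\Lambda_L)$ put $\|\Phi\|_{\Sigma^{-1}}^2=\sum_k\lambda_k^{-1}|\Phi.e_k|^2\in[0,\infty]$, and let $W^2_{\Sigma^{-1}}(\nu,\mu)=\inf_\pi\int\|\Phi-\Psi\|_{\Sigma^{-1}}^2\,d\pi(\Phi,\Psi)$, the infimum being over all couplings $\pi$ of $\nu$ and $\mu$. Then for every probability measure $\nu$ on $H^{-s}(\Lambda_L)$, $$W^2_{\Sigma^{-1}}(\nu,\mu)\le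 2\,\mathcal H(\nu|\mu).$$ -/

import Mathlib

namespace TorusField

open MeasureTheory ProbabilityTheory Filter Topology
open scoped ENNReal ContDiff NNReal

/-- The torus `Λ_L`, identified with the box `(-L/2, L/2]²`. -/
def box (L : ℝ) : Set (Fin 2 → ℝ) := Set.univ.pi fun _ => Set.Ioc (-(L / 2)) (L / 2)

/-- `C^∞(Λ_L)`: smooth functions on the plane that are `L`-periodic in each coordinate. -/
def SmoothTorus (L : ℝ) : Submodule ℝ ((Fin 2 → ℝ) → ℝ) where
  carrier := {φ | ContDiff ℝ ∞ φ ∧ ∀ x i, φ (x + Pi.single i L) = φ x}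
  zero_mem' := ⟨contDiff_const, fun _ _ => rfl⟩
  add_mem' := by
    rintro f g ⟨hf, hf'⟩ ⟨hg, hg'⟩
    exact ⟨hf.add hg, fun x i => by simp [hf', hg']⟩
  smul_mem' := by
    rintro c f ⟨hf, hf'⟩
    exact ⟨contDiff_const.smul hf, fun x i => by simp [hf']⟩

/-- The partial derivative `∂_i` on `C^∞(Λ_L)`. -/
noncomputable def partialDeriv (L : ℝ) (i : Fin 2) : SmoothTorus L →ₗ[ℝ] SmoothTorus L where
  toFun φ := ⟨fun x => fderiv ℝ φ.1 x (Pi.single i 1), by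
    refine ⟨(φ.2.1.fderiv_right (m := ∞) (by simp)).clm_apply contDiff_const, fun x j => ?_⟩
    have h : (fun y => φ.1 (y + Pi.single j L)) = φ.1 := funext fun y => φ.2.2 y j
    have h2 := fderiv_comp_add_right (𝕜 := ℝ) (f := φ.1) (x := x) (Pi.single j L)
    rw [h] at h2
    simp only [← h2]⟩
  map_add' φ ψ := by
    ext x
    simp only [Submodule.coe_add, Pi.add_apply]
    rw [fderiv_add (φ.2.1.differentiable (by simp) x) (ψ.2.1.differentiable (by simp) x)]
    rfl
  map_smul' c φ := by
    ext x
    simp only [Submodule.coe_smul, RingHom.id_apply, Pi.smul_apply]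
    rw [fderiv_const_smul (φ.2.1.differentiable (by simp) x)]
    rfl

/-- The point `ξ = (2π/L) n` of the frequency space `Λ_L^* = (2π/L) ℤ²`. -/
noncomputable def freq (L : ℝ) (n : Fin 2 → ℤ) (i : Fin 2) : ℝ := 2 * Real.pi / L * n i

/-- `|ξ|²` for `ξ = (2π/L) n`. -/
noncomputable def freqSq (L : ℝ) (n : Fin 2 → ℤ) : ℝ := ∑ i, freq L n i ^ 2

/-- The Fourier coefficient `φ̂(ξ) = ∫_{Λ_L} φ(x) e^{-i ξ·x} dx` at `ξ = (2π/L) n`. -/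
noncomputable def fourierCoef (L : ℝ) (φ : SmoothTorus L) (n : Fin 2 → ℤ) : ℂ :=
  ∫ x in box L, (φ.1 x : ℂ) * Complex.exp (-(Complex.I * ((∑ i, freq L n i * x i : ℝ) : ℂ)))

lemma freqSq_nonneg (L : ℝ) (n : Fin 2 → ℤ) : 0 ≤ freqSq L n :=
  Finset.sum_nonneg fun _ _ => sq_nonneg _

lemma box_ae_eq (L : ℝ) : box L =ᵐ[volume]
    Set.Icc (fun _ : Fin 2 => -(L / 2)) (fun _ => L / 2) :=
  Measure.univ_pi_Ioc_ae_eq_Icc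

lemma volume_box_lt_top (L : ℝ) : volume (box L) < ⊤ := by
  rw [measure_congr (box_ae_eq L)]
  exact isCompact_Icc.measure_lt_top

lemma integrableOn_box {E : Type*} [NormedAddCommGroup E] {L : ℝ} {f : (Fin 2 → ℝ) → E}
    (hf : Continuous f) : IntegrableOn f (box L) :=
  (hf.continuousOn.integrableOn_compact isCompact_Icc).congr_set_ae (box_ae_eq L)

/-- The integral over the torus of a partial derivative of a periodic function vanishes. -/
lemma integral_partial_eq_zero {L : ℝ} (hL : 0 < L) (i : Fin 2) (h : (Fin 2 → ℝ) → ℂ)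
    (hh : ContDiff ℝ ∞ h) (hper : ∀ x, h (x + Pi.single i L) = h x) :
    ∫ x in box L, fderiv ℝ h x (Pi.single i 1) = 0 := by
  have hc : Continuous fun x => fderiv ℝ h x (Pi.single i 1) :=
    ((hh.fderiv_right (m := ∞) (by simp)).clm_apply contDiff_const).continuous
  rw [setIntegral_congr_set (box_ae_eq L)]
  have key := integral_divergence_of_hasFDerivAt_off_countable' (n := 1) (E := ℂ)
    (fun _ => -(L / 2)) (fun _ => L / 2) (fun _ => by simp; linarith)
    (fun j x => if j = i then h x else 0)
    (fun j x => if j = i then fderiv ℝ h x else 0) ∅ Set.countable_empty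
    (fun j => by
      by_cases hj : j = i
      · simpa [hj] using hh.continuous.continuousOn
      · simpa [hj] using continuousOn_const)
    (fun x _ j => by
      by_cases hj : j = i
      · simpa [hj] using (hh.differentiable (by simp) x).hasFDerivAt
      · simpa [hj] using hasFDerivAt_const (0 : ℂ) x)
  have e1 : ∀ x, (∑ j : Fin 2, (if j = i then fderiv ℝ h x else 0 : (Fin 2 → ℝ) →L[ℝ] ℂ)
      (Pi.single j 1)) = fderiv ℝ h x (Pi.single i 1) := by
    intro x
    rw [Finset.sum_eq_single i (fun j _ hj => by simp [hj]) (by simp)]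
    simp
  refine Eq.trans (integral_congr_ae (Eventually.of_forall fun x => (e1 x).symm)) ?_
  refine (key ?_).trans ?_
  · refine IntegrableOn.congr_fun (f := fun x => fderiv ℝ h x (Pi.single i 1)) 
      (hc.continuousOn.integrableOn_compact isCompact_Icc) (fun x _ => (e1 x).symm)
      measurableSet_Icc
  · refine Finset.sum_eq_zero fun j _ => ?_
    by_cases hj : j = i
    · subst hj
      simp only [if_true]
      rw [sub_eq_zero]
      refine integral_congr_ae (Eventually.of_forall fun x => ?_)
      simp only
      rw [← hper (j.insertNth (-(L / 2)) x)]
      congr 1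
      ext k
      refine Fin.succAboveCases j ?_ (fun k => ?_) k
      · simp; ring
      · simp [Fin.succAbove_ne]
    · simp [hj]

lemma fourierCoef_partialDeriv {L : ℝ} (hL : 0 < L) (i : Fin 2) (φ : SmoothTorus L)
    (n : Fin 2 → ℤ) :
    fourierCoef L (partialDeriv L i φ) n = Complex.I * freq L n i * fourierCoef L φ n := by
  set e : (Fin 2 → ℝ) → ℂ := fun x =>
    Complex.exp (-(Complex.I * ((∑ i, freq L n i * x i : ℝ) : ℂ))) with he
  have hlin : ContDiff ℝ ∞ fun x : Fin 2 → ℝ => ((∑ i, freq L n i * x i : ℝ) : ℂ) := by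
    refine Complex.ofRealCLM.contDiff.comp (g := Complex.ofRealCLM)
      (f := fun x : Fin 2 → ℝ => ∑ i, freq L n i * x i) ?_
    fun_prop
  have hes : ContDiff ℝ ∞ e := by
    refine ContDiff.cexp ?_
    exact (contDiff_const.mul hlin).neg
  have hφ : ContDiff ℝ ∞ fun x => (φ.1 x : ℂ) := Complex.ofRealCLM.contDiff.comp φ.2.1
  have hde : ∀ x, HasFDerivAt e (e x • -(Complex.I • Complex.ofRealCLM.comp
      (∑ k, freq L n k • ContinuousLinearMap.proj (R := ℝ) (φ := fun _ : Fin 2 => ℝ) k))) x := by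
    intro x
    refine HasFDerivAt.cexp ?_
    refine HasFDerivAt.neg ?_
    refine HasFDerivAt.const_mul ?_ _
    refine HasFDerivAt.comp (g := Complex.ofRealCLM)
      (f := fun x : Fin 2 → ℝ => ∑ i, freq L n i * x i) x Complex.ofRealCLM.hasFDerivAt ?_
    refine HasFDerivAt.fun_sum fun k _ => ?_
    exact (ContinuousLinearMap.proj (R := ℝ) (φ := fun _ : Fin 2 => ℝ) k).hasFDerivAt.const_mul _
  have hdφ : ∀ x, HasFDerivAt (fun x => (φ.1 x : ℂ))
      (Complex.ofRealCLM.comp (fderiv ℝ φ.1 x)) x := fun x =>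
    Complex.ofRealCLM.hasFDerivAt.comp x (φ.2.1.differentiable (by simp) x).hasFDerivAt
  have h0 := integral_partial_eq_zero hL i (fun x => (φ.1 x : ℂ) * e x) (hφ.mul hes) (by
    intro x
    simp only [φ.2.2 x i]
    congr 1
    simp only [he]
    rw [Complex.exp_eq_exp_iff_exists_int]
    refine ⟨-n i, ?_⟩
    have : (∑ k, freq L n k * (x + Pi.single i L : Fin 2 → ℝ) k : ℝ)
        = (∑ k, freq L n k * x k) + 2 * Real.pi * n i := by
      simp only [Pi.add_apply, mul_add, Finset.sum_add_distrib, Pi.single_apply, mul_ite, mul_zero,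
        Finset.sum_ite_eq', Finset.mem_univ, if_true, freq]
      field_simp
    rw [this]
    push_cast
    ring)
  have hd : ∀ x, fderiv ℝ (fun x => (φ.1 x : ℂ) * e x) x (Pi.single i 1) =
      ((partialDeriv L i φ).1 x : ℂ) * e x - Complex.I * freq L n i * ((φ.1 x : ℂ) * e x) := by
    intro x
    have hm : HasFDerivAt (fun x => (φ.1 x : ℂ) * e x) _ x := (hdφ x).mul (hde x)
    rw [hm.fderiv]
    fin_cases i <;> simp [partialDeriv] <;> ring
  simp_rw [hd] at h0
  rw [integral_sub, integral_const_mul, sub_eq_zero] at h0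
  · exact h0
  · exact integrableOn_box ((Complex.continuous_ofReal.comp
      (partialDeriv L i φ).2.1.continuous).mul hes.continuous)
  · exact integrableOn_box (continuous_const.mul (hφ.continuous.mul hes.continuous))

lemma norm_fourierCoef_le (L : ℝ) (φ : SmoothTorus L) :
    ∃ C : ℝ, ∀ n, ‖fourierCoef L φ n‖ ≤ C := by
  refine ⟨∫ x in box L, |φ.1 x|, fun n => ?_⟩
  refine (norm_integral_le_integral_norm _).trans (le_of_eq ?_)
  refine integral_congr_ae (Eventually.of_forall fun x => ?_)
  simp only [norm_mul, Complex.norm_real, Real.norm_eq_abs]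
  rw [Complex.norm_exp]
  simp

lemma pow_mul_norm_fourierCoef_le {L : ℝ} (hL : 0 < L) (φ : SmoothTorus L) (k : ℕ) :
    ∃ C : ℝ, ∀ n i, |freq L n i| ^ k * ‖fourierCoef L φ n‖ ≤ C := by
  have h1 : ∀ (i : Fin 2) (n : Fin 2 → ℤ) (k : ℕ),
      ‖fourierCoef L ((partialDeriv L i)^[k] φ) n‖
        = |freq L n i| ^ k * ‖fourierCoef L φ n‖ := by
    intro i n k
    induction k with
    | zero => simp
    | succ k ih =>
      rw [Function.iterate_succ_apply', fourierCoef_partialDeriv hL, norm_mul, ih]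
      simp [pow_succ]; ring
  choose C hC using fun i : Fin 2 => norm_fourierCoef_le L ((partialDeriv L i)^[k] φ)
  refine ⟨∑ i, |C i|, fun n i => ?_⟩
  rw [← h1 i n k]
  refine ((hC i n).trans (le_abs_self _)).trans ?_
  exact Finset.single_le_sum (f := fun i => |C i|) (fun _ _ => abs_nonneg _) (Finset.mem_univ i)

lemma summable_sobolev (L s : ℝ) (φ : SmoothTorus L) :
    Summable fun n => (1 + freqSq L n) ^ s * ‖fourierCoef L φ n‖ ^ 2 := by
  rcases le_or_gt L 0 with hL | hL
  · have : box L = ∅ := by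
      rw [box, Set.univ_pi_eq_empty_iff]
      exact ⟨0, Set.Ioc_eq_empty (by linarith)⟩
    simp [fourierCoef, this, summable_zero]
  obtain ⟨K, hK⟩ := exists_nat_ge s
  obtain ⟨C, hC⟩ := pow_mul_norm_fourierCoef_le hL φ (K + 2)
  set a := 2 * Real.pi / L with ha
  have hapos : 0 < a := by positivity
  set D := (1 + 2 * a ^ 2) ^ K * (C / a ^ (K + 2)) ^ 2 with hD
  have hS := (EisensteinSeries.summable_one_div_norm_rpow (k := 4) (by norm_num)).mul_left D
  refine Summable.of_norm_bounded_eventually hS ?_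
  have : ∀ᶠ n : Fin 2 → ℤ in cofinite, n ≠ 0 := by
    simp
  filter_upwards [this] with n hn
  have hpos : 0 ≤ 1 + freqSq L n := by have := freqSq_nonneg L n; linarith
  rw [Real.norm_of_nonneg (mul_nonneg (Real.rpow_nonneg hpos _) (sq_nonneg _))]
  have hn1 : 1 ≤ ‖n‖ := by
    obtain ⟨j, hj⟩ : ∃ j, n j ≠ 0 := by
      by_contra! h; exact hn (funext h)
    refine le_trans ?_ (norm_le_pi_norm n j)
    rw [Int.norm_eq_abs]
    exact_mod_cast Int.one_le_abs hj
  obtain ⟨i, hi⟩ : ∃ i, ‖n i‖ = ‖n‖ := by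
    obtain ⟨i, hi⟩ := Finite.exists_max fun i => ‖n i‖
    exact ⟨i, le_antisymm (norm_le_pi_norm n i) ((pi_norm_le_iff_of_nonneg (norm_nonneg _)).2 hi)⟩
  have hfi : |freq L n i| = a * ‖n‖ := by
    rw [freq, abs_mul, abs_of_pos hapos, ← hi, Int.norm_eq_abs]
  have hsq : freqSq L n ≤ 2 * a ^ 2 * ‖n‖ ^ 2 := by
    have : ∀ j, freq L n j ^ 2 ≤ a ^ 2 * ‖n‖ ^ 2 := by
      intro j
      rw [freq, mul_pow]
      refine mul_le_mul_of_nonneg_left ?_ (sq_nonneg _)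
      rw [← sq_abs, ← Int.norm_eq_abs]
      exact pow_le_pow_left₀ (norm_nonneg _) (norm_le_pi_norm n j) 2
    rw [freqSq, Fin.sum_univ_two]
    linarith [this 0, this 1]
  have h1 : (1 + freqSq L n) ^ s ≤ (1 + 2 * a ^ 2) ^ K * ‖n‖ ^ (2 * K) := by
    calc (1 + freqSq L n) ^ s ≤ (1 + freqSq L n) ^ (K : ℝ) :=
          Real.rpow_le_rpow_of_exponent_le (by linarith [freqSq_nonneg L n]) hK
      _ = (1 + freqSq L n) ^ K := Real.rpow_natCast _ _
      _ ≤ ((1 + 2 * a ^ 2) * ‖n‖ ^ 2) ^ K := by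
          gcongr
          nlinarith [one_le_pow₀ (n := 2) hn1]
      _ = _ := by rw [mul_pow, ← pow_mul]
  have h2 : ‖fourierCoef L φ n‖ ≤ C / a ^ (K + 2) / ‖n‖ ^ (K + 2) := by
    have := hC n i
    rw [hfi, mul_pow] at this
    rw [div_div, le_div_iff₀ (by positivity)]
    linarith
  have hn0 : 0 < ‖n‖ := by linarith
  calc (1 + freqSq L n) ^ s * ‖fourierCoef L φ n‖ ^ 2
      ≤ ((1 + 2 * a ^ 2) ^ K * ‖n‖ ^ (2 * K)) * (C / a ^ (K + 2) / ‖n‖ ^ (K + 2)) ^ 2 := by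
        gcongr
    _ = D * ‖n‖ ^ (-4 : ℝ) := by
        rw [hD, Real.rpow_neg hn0.le]
        norm_cast
        field_simp
        ring

/-- `C^∞(Λ_L)` equipped with the Sobolev norm of order `s`,
`‖φ‖² = L⁻² ∑_ξ (1 + |ξ|²)^s |φ̂(ξ)|²`. -/
def TestSpace (L _s : ℝ) : Type := SmoothTorus L

noncomputable instance (L s : ℝ) : AddCommGroup (TestSpace L s) :=
  inferInstanceAs (AddCommGroup (SmoothTorus L))

noncomputable instance (L s : ℝ) : Module ℝ (TestSpace L s) :=
  inferInstanceAs (Module ℝ (SmoothTorus L))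

/-- A smooth function regarded as an element of `C^∞(Λ_L)` with the `H^s` norm. -/
noncomputable def toTest (L s : ℝ) : SmoothTorus L ≃ₗ[ℝ] TestSpace L s :=
  LinearEquiv.refl ℝ (SmoothTorus L)

lemma fourierCoef_add (L : ℝ) (φ ψ : SmoothTorus L) (n : Fin 2 → ℤ) :
    fourierCoef L (φ + ψ) n = fourierCoef L φ n + fourierCoef L ψ n := by
  have hc : ∀ φ : SmoothTorus L, IntegrableOn (fun x => (φ.1 x : ℂ) *
      Complex.exp (-(Complex.I * ((∑ i, freq L n i * x i : ℝ) : ℂ)))) (box L) := by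
    intro φ
    refine integrableOn_box ?_
    have := φ.2.1.continuous
    fun_prop
  rw [fourierCoef, fourierCoef, fourierCoef, ← integral_add (hc φ) (hc ψ)]
  refine integral_congr_ae (Eventually.of_forall fun x => ?_)
  simp [add_mul]

lemma fourierCoef_smul (L : ℝ) (c : ℝ) (φ : SmoothTorus L) (n : Fin 2 → ℤ) :
    fourierCoef L (c • φ) n = c * fourierCoef L φ n := by
  rw [fourierCoef, fourierCoef, ← integral_const_mul]
  refine integral_congr_ae (Eventually.of_forall fun x => ?_)
  simp [mul_assoc]

/-- The sequence `ξ ↦ L⁻¹ (1 + |ξ|²)^{s/2} φ̂(ξ)`, whose `ℓ²` norm is the `H^s` norm of `φ`. -/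
noncomputable def sobolevSeq (L s : ℝ) :
    SmoothTorus L →ₗ[ℝ] lp (fun _ : Fin 2 → ℤ => ℂ) 2 where
  toFun φ := ⟨fun n => ((L⁻¹ * (1 + freqSq L n) ^ (s / 2) : ℝ) : ℂ) * fourierCoef L φ n, by
    refine (memℓp_gen_iff (by norm_num)).2 ?_
    refine ((summable_sobolev L s φ).mul_left ((L⁻¹) ^ 2)).congr fun n => ?_
    have hpos : 0 ≤ 1 + freqSq L n := by have := freqSq_nonneg L n; linarith
    have h2 : ((1 + freqSq L n) ^ (s / 2)) ^ 2 = (1 + freqSq L n) ^ s := by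
      rw [← Real.rpow_natCast, ← Real.rpow_mul hpos]; norm_num
    simp only [ENNReal.toReal_ofNat, Real.rpow_ofNat, norm_mul, Complex.norm_real, mul_pow,
      Real.norm_eq_abs, sq_abs, h2]
    ring⟩
  map_add' φ ψ := by
    ext n
    simp only [lp.coeFn_add, Pi.add_apply]
    rw [← mul_add]
    congr 1
    exact (fourierCoef_add L φ ψ n)
  map_smul' c φ := by
    ext n
    simp only [lp.coeFn_smul, Pi.smul_apply, RingHom.id_apply, Complex.real_smul]
    rw [mul_left_comm]
    congr 1
    exact fourierCoef_smul L c φ n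

noncomputable instance (L s : ℝ) : SeminormedAddCommGroup (TestSpace L s) :=
  SeminormedAddCommGroup.induced _ _ (sobolevSeq L s ∘ₗ (toTest L s).symm.toLinearMap)

noncomputable instance (L s : ℝ) : NormedSpace ℝ (TestSpace L s) :=
  NormedSpace.induced ℝ _ _ (sobolevSeq L s ∘ₗ (toTest L s).symm.toLinearMap)

lemma norm_sq_toTest (L s : ℝ) (φ : SmoothTorus L) :
    ‖toTest L s φ‖ ^ 2 = (L ^ 2)⁻¹ * ∑' n, (1 + freqSq L n) ^ s * ‖fourierCoef L φ n‖ ^ 2 := by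
  have h : ‖toTest L s φ‖ = ‖sobolevSeq L s φ‖ := rfl
  have h' := lp.norm_rpow_eq_tsum (p := 2) (by norm_num) (sobolevSeq L s φ)
  simp only [ENNReal.toReal_ofNat, Real.rpow_ofNat] at h'
  rw [h, h', ← tsum_mul_left]
  refine tsum_congr fun n => ?_
  have hpos : 0 ≤ 1 + freqSq L n := by have := freqSq_nonneg L n; linarith
  have h2 : ((1 + freqSq L n) ^ (s / 2)) ^ 2 = (1 + freqSq L n) ^ s := by
    rw [← Real.rpow_natCast, ← Real.rpow_mul hpos]; norm_num
  have h3 : sobolevSeq L s φ n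
    = ((L⁻¹ * (1 + freqSq L n) ^ (s / 2) : ℝ) : ℂ) * fourierCoef L φ n := rfl
  rw [h3]
  simp only [norm_mul, Complex.norm_real, mul_pow, Real.norm_eq_abs, sq_abs, h2]
  ring

/-- `H^{-s}(Λ_L)`, the dual of `H^s(Λ_L)`: the distributions on the torus that are bounded with
respect to the `H^s` norm (`C^∞(Λ_L)` is dense in `H^s(Λ_L)`), with the dual norm. -/
abbrev NegSobolev (L s : ℝ) : Type := StrongDual ℝ (TestSpace L s)

noncomputable instance (L s : ℝ) : MeasurableSpace (NegSobolev L s) := borel _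

instance (L s : ℝ) : BorelSpace (NegSobolev L s) := ⟨rfl⟩

/-- The distribution `φ ↦ Z.φ` on `C^∞(Λ_L)` underlying `Z ∈ H^{-s}(Λ_L)`. -/
noncomputable def toDist {L s : ℝ} (Z : NegSobolev L s) : SmoothTorus L →ₗ[ℝ] ℝ :=
  (Z : TestSpace L s →ₗ[ℝ] ℝ) ∘ₗ (toTest L s).toLinearMap

/-- The real Hilbert space `L²(Λ_L)`. -/
abbrev L2 (L : ℝ) : Type := Lp ℝ 2 (volume.restrict (box L))

lemma memLp_smooth (L : ℝ) (φ : SmoothTorus L) : MemLp φ.1 2 (volume.restrict (box L)) :=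
  (memLp_two_iff_integrable_sq φ.2.1.continuous.aestronglyMeasurable).2
    (integrableOn_box (φ.2.1.continuous.pow 2))

/-- The embedding `C^∞(Λ_L) → L²(Λ_L)`. -/
noncomputable def toL2 (L : ℝ) (φ : SmoothTorus L) : L2 L := (memLp_smooth L φ).toLp φ.1

/-- `‖T‖²_{L²(Λ_L)}` of a distribution `T`: it is `‖f‖²` if `T` is integration against some (unique)
`f ∈ L²(Λ_L)`, and `∞` otherwise. -/
noncomputable def l2NormSq {L : ℝ} (T : SmoothTorus L →ₗ[ℝ] ℝ) : ℝ≥0∞ :=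
  ⨅ (f : L2 L) (_ : ∀ φ : SmoothTorus L, T φ = ∫ x in box L, f x * φ.1 x), ‖f‖ₑ ^ 2

/-- The distributional derivative `(∂_i T).φ = -T.(∂_i φ)`. -/
noncomputable def distDeriv {L : ℝ} (i : Fin 2) (T : SmoothTorus L →ₗ[ℝ] ℝ) :
    SmoothTorus L →ₗ[ℝ] ℝ := -(T ∘ₗ partialDeriv L i)

/-- `‖T‖²_{H^1_m(Λ_L)} = ‖∇T‖²_{L²} + m² ‖T‖²_{L²}`, possibly infinite. -/
noncomputable def h1NormSq {L : ℝ} (m : ℝ) (T : SmoothTorus L →ₗ[ℝ] ℝ) : ℝ≥0∞ :=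
  ∑ i, l2NormSq (distDeriv i T) + ENNReal.ofReal (m ^ 2) * l2NormSq T

/-- Optimal transport cost: the infimum of `∫ c dπ` over all couplings `π` of `μ` and `ν`. -/
noncomputable def transportCost {X : Type*} [MeasurableSpace X] (c : X → X → ℝ≥0∞)
    (μ ν : Measure X) : ℝ≥0∞ :=
  ⨅ (π : Measure (X × X)) (_ : π.map Prod.fst = μ) (_ : π.map Prod.snd = ν),
    ∫⁻ p, c p.1 p.2 ∂π

/-- The distance `W_{H^1_m(Λ_L)^N}`, with its normalization `1/N`. The product σ-algebra on
`H^{-s}(Λ_L)^N` is the Borel one because `H^{-s}(Λ_L)` is separable. -/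
noncomputable def wassersteinH1 {L s : ℝ} (m : ℝ) (N : ℕ)
    (μ ν : Measure (Fin N → NegSobolev L s)) : ℝ≥0∞ :=
  (transportCost (fun X Y => (N : ℝ≥0∞)⁻¹ * ∑ j, h1NormSq m (toDist (X j - Y j))) μ ν) ^
    (1 / 2 : ℝ)

/-- `μ` is the centered Gaussian measure on `H^{-s}(Λ_L)` with covariance `C`:
`E[(Z.φ)(Z.ψ)] = C φ ψ` for smooth `φ, ψ`. -/
structure IsCenteredGaussian {L s : ℝ} (μ : Measure (NegSobolev L s))
    (C : SmoothTorus L → SmoothTorus L → ℝ) : Prop where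
  gaussian : IsGaussian μ
  mean_zero : ∀ φ, ∫ Z, toDist Z φ ∂μ = 0
  covariance : ∀ φ ψ, ∫ Z, toDist Z φ * toDist Z ψ ∂μ = C φ ψ

/-- The inner product `⟨φ, ψ⟩_{H^{-1}_m} = L⁻² ∑_ξ φ̂(ξ) conj(ψ̂(ξ)) / (m² + |ξ|²)`. For real `φ, ψ`
the terms at `ξ` and `-ξ` are conjugate, so only real parts contribute. -/
noncomputable def massiveInner (L m : ℝ) (φ ψ : SmoothTorus L) : ℝ :=
  (L ^ 2)⁻¹ * ∑' n, (fourierCoef L φ n * starRingEnd ℂ (fourierCoef L ψ n)).re /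
    (m ^ 2 + freqSq L n)

/-- `μ = μ_{m,L}` is the law of the massive Gaussian free field on `Λ_L` with mass `m`. -/
def IsMassiveGFF {L s : ℝ} (m : ℝ) (μ : Measure (NegSobolev L s)) : Prop :=
  IsCenteredGaussian μ (massiveInner L m)

/-- The seminorm `‖T‖²_{Σ⁻¹} = ∑_k |T.e_k|² / λ_k`, possibly infinite, attached to a diagonalizing
basis `e` with eigenvalues `ev`. -/
noncomputable def spectralNormSq {L : ℝ} (e : ℕ → SmoothTorus L) (ev : ℕ → ℝ)
    (T : SmoothTorus L →ₗ[ℝ] ℝ) : ℝ≥0∞ :=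
  ∑' k, ENNReal.ofReal (T (e k) ^ 2 / ev k)


lemma summable_mul_lp {ι : Type*} {a : ι → ℝ} (ha : Summable fun i => a i ^ 2)
    (u : lp (fun _ : ι => ℝ) 2) : Summable fun i => a i ^ 2 * u i ^ 2 := by
  have hb : ∀ i, u i ^ 2 ≤ ‖u‖ ^ 2 := fun i => by
    have := lp.norm_apply_le_norm (by norm_num : (2 : ℝ≥0∞) ≠ 0) u i
    rw [← sq_abs, ← Real.norm_eq_abs]
    exact pow_le_pow_left₀ (norm_nonneg _) this 2
  exact Summable.of_nonneg_of_le (fun i => by positivity)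
    (fun i => mul_le_mul_of_nonneg_left (hb i) (sq_nonneg _)) (ha.mul_right _)

/-- Existence of centered Gaussian measures on `ℓ²` with diagonal trace-class covariance: the law
under `P` of `w ↦ (a_i w_i)_i` for i.i.d. standard Gaussians `w_i`. -/
lemma exists_gaussian_lp {ι : Type*} [Countable ι]
    [MeasurableSpace (lp (fun _ : ι => ℝ) 2)] [BorelSpace (lp (fun _ : ι => ℝ) 2)] (a : ι → ℝ) (ha : Summable fun i => a i ^ 2) :
    ∃ ν : Measure (lp (fun _ : ι => ℝ) 2), ∀ u : lp (fun _ : ι => ℝ) 2,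
      ν.map (fun h => inner ℝ h u) = gaussianReal 0 (∑' i, a i ^ 2 * u i ^ 2).toNNReal := by
  classical
  set P : Measure (ι → ℝ) := Measure.infinitePi fun _ => gaussianReal 0 1 with hP
  have hPi : ∀ i, P.map (fun w => w i) = gaussianReal 0 1 := fun i => by
    rw [hP]; exact Measure.infinitePi_map_eval _ i
  have hmul : ∀ c : ℝ, ∀ i, Measurable fun w : ι → ℝ => c * w i := fun c i =>
    Measurable.const_mul (f := fun w : ι → ℝ => w i) (measurable_pi_apply i) c
  have hsm : ∀ i, Measurable fun w : ι → ℝ => ENNReal.ofReal ((a i * w i) ^ 2) := fun i =>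
    ((hmul _ i).pow_const 2).ennreal_ofReal
  have hsum : ∀ F : Finset ι, ∀ c : ι → ℝ, Measurable fun w : ι → ℝ => ∑ i ∈ F, c i * w i :=
    fun F c => Finset.measurable_fun_sum F fun i _ => hmul (c i) i
  have hae : ∀ᵐ w ∂P, Summable fun i => (a i * w i) ^ 2 := by
    have hfin : ∫⁻ w, ∑' i, ENNReal.ofReal ((a i * w i) ^ 2) ∂P ≠ ⊤ := by
      rw [lintegral_tsum fun i => (hsm i).aemeasurable]
      have : ∀ i, ∫⁻ w, ENNReal.ofReal ((a i * w i) ^ 2) ∂P = ENNReal.ofReal (a i ^ 2) := by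
        intro i
        have h1 : ∫⁻ w, ENNReal.ofReal ((a i * w i) ^ 2) ∂P
            = ∫⁻ x, ENNReal.ofReal ((a i * x) ^ 2) ∂(gaussianReal 0 1) := by
          rw [← hPi i, lintegral_map (by fun_prop) (by fun_prop)]
        rw [h1, ← ofReal_integral_eq_lintegral_ofReal]
        · congr 1
          simp_rw [mul_pow]
          rw [integral_const_mul]
          have := variance_id_gaussianReal (μ := 0) (v := 1)
          rw [variance_of_integral_eq_zero (by fun_prop) (by simp)] at this
          simp at this
          rw [this, mul_one]
        · simp_rw [mul_pow]
          refine Integrable.const_mul ?_ _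
          exact (memLp_id_gaussianReal (μ := 0) (v := 1) 2).integrable_sq
        · exact Eventually.of_forall fun x => sq_nonneg _
      simp_rw [this]
      rw [← ENNReal.ofReal_tsum_of_nonneg (fun i => sq_nonneg _) ha]
      exact ENNReal.ofReal_ne_top
    filter_upwards [ae_lt_top (Measurable.tsum hsm) hfin] with w hw
    have := ENNReal.summable_toReal hw.ne
    refine this.congr fun i => ?_
    rw [ENNReal.toReal_ofReal (sq_nonneg _)]
  have hmem : ∀ w : ι → ℝ, (Summable fun i => (a i * w i) ^ 2) →
      Memℓp (fun i => a i * w i) 2 := by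
    intro w hw
    rw [memℓp_gen_iff (by norm_num)]
    refine hw.congr fun i => ?_
    simp [mul_pow]
  set h : (ι → ℝ) → lp (fun _ : ι => ℝ) 2 := fun w =>
    if hw : Memℓp (E := fun _ : ι => ℝ) (fun i => a i * w i) 2 then ⟨_, hw⟩ else 0 with hh
  have hlim : ∀ᵐ w ∂P, Tendsto (fun F : Finset ι => ∑ i ∈ F, lp.single 2 i (a i * w i)) atTop
      (𝓝 (h w)) := by
    filter_upwards [hae] with w hw
    have h1 : h w = ⟨_, hmem w hw⟩ := by simp [hh, hmem w hw]
    have := lp.hasSum_single (p := 2) (by norm_num) (h w)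
    rw [h1] at this ⊢
    exact this
  have hFm : ∀ F : Finset ι, Measurable fun w : ι → ℝ =>
      (∑ i ∈ F, lp.single 2 i (a i * w i) : lp (fun _ : ι => ℝ) 2) := by
    intro F
    refine Continuous.measurable ?_
    refine continuous_finsetSum _ fun i _ => ?_
    have : (fun w : ι → ℝ => lp.single (E := fun _ : ι => ℝ) 2 i (a i * w i)) =
        fun w => (a i * w i) • lp.single (E := fun _ : ι => ℝ) 2 i 1 := by
      funext w
      rw [← lp.single_smul]; simp
    rw [this]
    fun_prop
  have hm : AEMeasurable h P :=
    aemeasurable_of_tendsto_metrizable_ae atTop (fun F => (hFm F).aemeasurable) hlim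
  refine ⟨P.map h, fun u => ?_⟩
  set Q := ∑' i, a i ^ 2 * u i ^ 2 with hQ
  have hQs := summable_mul_lp ha u
  have hQ0 : 0 ≤ Q := tsum_nonneg fun i => by positivity
  rw [AEMeasurable.map_map_of_aemeasurable (by fun_prop) hm]
  have hprob : IsProbabilityMeasure (P.map ((fun h => inner ℝ h u) ∘ h)) :=
    Measure.isProbabilityMeasure_map
      ((by fun_prop : Measurable fun h : lp (fun _ : ι => ℝ) 2 => inner ℝ h u).comp_aemeasurable hm)
  refine Measure.ext_of_charFun ?_
  ext t
  have hF : ∀ F : Finset ι, ∫ w, Complex.exp (t * (∑ i ∈ F, a i * u i * w i : ℝ) * Complex.I) ∂P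
      = Complex.exp (-((∑ i ∈ F, a i ^ 2 * u i ^ 2 : ℝ) * t ^ 2 / 2)) := by
    intro F
    have hind : iIndepFun (fun i (w : ι → ℝ) => a i * u i * w i) P :=
      iIndepFun_infinitePi (X := fun i x => a i * u i * x) (by fun_prop)
    have hc := (hind.restrict F).charFun_map_fun_finsetSum_eq_prod (fun i _ => (hmul _ i).aemeasurable)
    have hc := congrFun hc t
    rw [charFun_apply_real, integral_map (hsum F fun i => a i * u i).aemeasurable (by fun_prop)] at hc
    rw [hc, Finset.prod_apply]
    have : ∀ i, charFun (P.map fun w => a i * u i * w i) t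
        = Complex.exp (-((a i ^ 2 * u i ^ 2 : ℝ) * t ^ 2 / 2)) := by
      intro i
      have : P.map (fun w => a i * u i * w i) = (gaussianReal 0 1).map (fun x => a i * u i * x) := by
        rw [← hPi i, Measure.map_map (by fun_prop) (by fun_prop)]; rfl
      rw [this, gaussianReal_map_const_mul, charFun_gaussianReal]
      congr 1
      simp [mul_pow]
    simp_rw [this]
    rw [← Complex.exp_sum]
    congr 1
    push_cast
    simp only [Finset.sum_mul, Finset.sum_div, Finset.sum_neg_distrib]
  have hlimL : Tendsto (fun F : Finset ι => ∫ w, Complex.exp (t * (∑ i ∈ F, a i * u i * w i : ℝ)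
      * Complex.I) ∂P) atTop (𝓝 (∫ w, Complex.exp (t * (inner ℝ (h w) u : ℝ) * Complex.I) ∂P)) := by
    refine tendsto_integral_filter_of_dominated_convergence (fun _ => 1) ?_ ?_ (by simp) ?_
    · refine Eventually.of_forall fun F => Measurable.aestronglyMeasurable ?_
      have h3 : Continuous fun x : ℝ => Complex.exp (t * (x : ℂ) * Complex.I) := by fun_prop
      exact h3.measurable.comp (hsum F fun i => a i * u i)
    · refine Eventually.of_forall fun F => Eventually.of_forall fun w => ?_
      rw [← Complex.ofReal_mul, Complex.norm_exp_ofReal_mul_I]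
    · filter_upwards [hlim] with w hw
      have h2 : Tendsto (fun F : Finset ι => (∑ i ∈ F, a i * u i * w i : ℝ)) atTop
          (𝓝 (inner ℝ (h w) u)) := by
        have := hw.inner (tendsto_const_nhds (x := u)) (𝕜 := ℝ)
        refine this.congr fun F => ?_
        rw [sum_inner]
        refine Finset.sum_congr rfl fun i _ => ?_
        rw [lp.inner_single_left]
        simp; ring
      have h3 : Continuous fun x : ℝ => Complex.exp (t * (x : ℂ) * Complex.I) := by fun_prop
      exact (h3.tendsto _).comp h2
  have hlimR : Tendsto (fun F : Finset ι => ∫ w, Complex.exp (t * (∑ i ∈ F, a i * u i * w i : ℝ)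
      * Complex.I) ∂P) atTop (𝓝 (Complex.exp (-((Q : ℝ) * t ^ 2 / 2)))) := by
    simp_rw [hF]
    have h3 : Continuous fun x : ℝ => Complex.exp (-((x : ℂ) * t ^ 2 / 2)) := by fun_prop
    exact (h3.tendsto _).comp hQs.hasSum
  rw [charFun_apply_real, integral_map
    ((by fun_prop : Measurable fun h : lp (fun _ : ι => ℝ) 2 => inner ℝ h u).comp_aemeasurable hm)
    (by fun_prop), charFun_gaussianReal]
  simp only [Function.comp]
  rw [tendsto_nhds_unique hlimL hlimR]
  congr 1
  rw [Real.coe_toNNReal _ hQ0]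
  simp

/-- The variance weights of the free field in `H^{-s}` are summable for `s > 0`. -/
lemma summable_weight {L m s : ℝ} (hL : 0 < L) (hs : 0 < s) :
    Summable fun n => (1 + freqSq L n) ^ (-s) / (m ^ 2 + freqSq L n) := by
  set a := 2 * Real.pi / L with ha
  have hapos : 0 < a := by positivity
  have hS := (EisensteinSeries.summable_one_div_norm_rpow (k := 2 + 2 * s) (by linarith)).mul_left
    ((a ^ 2) ^ (-s) / a ^ 2)
  refine Summable.of_norm_bounded_eventually hS ?_
  have : ∀ᶠ n : Fin 2 → ℤ in cofinite, n ≠ 0 := by simp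
  filter_upwards [this] with n hn
  have hn0 : 0 < ‖n‖ := norm_pos_iff.2 hn
  have hge : a ^ 2 * ‖n‖ ^ 2 ≤ freqSq L n := by
    obtain ⟨i, hi⟩ : ∃ i, ‖n i‖ = ‖n‖ := by
      obtain ⟨i, hi⟩ := Finite.exists_max fun i => ‖n i‖
      exact ⟨i, le_antisymm (norm_le_pi_norm n i)
        ((pi_norm_le_iff_of_nonneg (norm_nonneg _)).2 hi)⟩
    have : a ^ 2 * ‖n‖ ^ 2 = freq L n i ^ 2 := by
      rw [← hi, freq, mul_pow, Int.norm_eq_abs, sq_abs]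
    rw [this]
    exact Finset.single_le_sum (f := fun i => freq L n i ^ 2) (fun _ _ => sq_nonneg _)
      (Finset.mem_univ i)
  have hap : 0 < a ^ 2 * ‖n‖ ^ 2 := by positivity
  have hm : 0 < m ^ 2 + freqSq L n := by nlinarith [sq_nonneg m]
  have h1 : 0 < 1 + freqSq L n := by linarith
  rw [Real.norm_of_nonneg (by positivity)]
  calc (1 + freqSq L n) ^ (-s) / (m ^ 2 + freqSq L n)
      ≤ (a ^ 2 * ‖n‖ ^ 2) ^ (-s) / (a ^ 2 * ‖n‖ ^ 2) := by
        refine div_le_div₀ (by positivity) ?_ hap (by nlinarith [sq_nonneg m])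
        exact Real.rpow_le_rpow_of_nonpos hap (by linarith) (by linarith)
    _ = (a ^ 2) ^ (-s) / a ^ 2 * ‖n‖ ^ (-(2 + 2 * s)) := by
        rw [Real.mul_rpow (by positivity) (by positivity), ← Real.rpow_natCast ‖n‖ 2,
          ← Real.rpow_mul hn0.le, Real.rpow_neg hn0.le (2 + 2 * s), Real.rpow_add hn0,
          show ((2 : ℕ) : ℝ) * -s = -(2 * s) by push_cast; ring, Real.rpow_neg hn0.le (2 * s)]
        push_cast
        field_simp

lemma summable_massive (L : ℝ) {m : ℝ} (hm : 0 < m) (φ ψ : SmoothTorus L) :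
    Summable fun n => (fourierCoef L φ n * starRingEnd ℂ (fourierCoef L ψ n)).re /
      (m ^ 2 + freqSq L n) := by
  have h := ((summable_sobolev L 0 φ).add (summable_sobolev L 0 ψ)).mul_left ((m ^ 2)⁻¹)
  refine Summable.of_norm_bounded h fun n => ?_
  have h0 := freqSq_nonneg L n
  simp only [Real.rpow_zero, one_mul]
  rw [norm_div, Real.norm_of_nonneg (by positivity : 0 ≤ m ^ 2 + freqSq L n), div_eq_inv_mul]
  have h1 : ‖(fourierCoef L φ n * starRingEnd ℂ (fourierCoef L ψ n)).re‖
      ≤ ‖fourierCoef L φ n‖ ^ 2 + ‖fourierCoef L ψ n‖ ^ 2 := by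
    refine (Complex.abs_re_le_norm _).trans ?_
    rw [norm_mul, RCLike.norm_conj]
    nlinarith [sq_nonneg (‖fourierCoef L φ n‖ - ‖fourierCoef L ψ n‖),
      sq_nonneg (‖fourierCoef L φ n‖), sq_nonneg (‖fourierCoef L ψ n‖)]
  have h2 : (m ^ 2 + freqSq L n)⁻¹ ≤ (m ^ 2)⁻¹ := by
    gcongr; linarith
  gcongr

lemma massiveInner_add_self (L : ℝ) {m : ℝ} (hm : 0 < m) (φ ψ : SmoothTorus L) :
    massiveInner L m (φ + ψ) (φ + ψ)
      = massiveInner L m φ φ + massiveInner L m ψ ψ + 2 * massiveInner L m φ ψ := by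
  simp only [massiveInner]
  rw [show ∀ c a b d : ℝ, c * a + c * b + 2 * (c * d) = c * (a + b + 2 * d) by intros; ring,
    ← tsum_mul_left (a := (2 : ℝ)), ← (summable_massive L hm φ φ).tsum_add (summable_massive L hm ψ ψ),
    ← ((summable_massive L hm φ φ).add (summable_massive L hm ψ ψ)).tsum_add
      ((summable_massive L hm φ ψ).mul_left 2)]
  congr 1
  refine tsum_congr fun n => ?_
  rw [fourierCoef_add]
  simp
  ring

/-- Existence of the massive Gaussian free field as a Borel measure on `H^{-s}(Λ_L)`, `s > 0`. -/
theorem exists_isMassiveGFF {L m s : ℝ} (hL : 0 < L) (hm : 0 < m) (hs : 0 < s) :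
    ∃ μ : Measure (NegSobolev L s), IsMassiveGFF m μ := by
  classical
  let _ : MeasurableSpace (lp (fun _ : (Fin 2 → ℤ) × Bool => ℝ) 2) := borel _
  have _ : BorelSpace (lp (fun _ : (Fin 2 → ℤ) × Bool => ℝ) 2) := ⟨rfl⟩
  have hpos : ∀ n, 0 < 1 + freqSq L n := fun n => by have := freqSq_nonneg L n; linarith
  have hmpos : ∀ n, 0 < m ^ 2 + freqSq L n := fun n => by
    have := freqSq_nonneg L n; positivity
  have hrt : ∀ n, ((1 + freqSq L n) ^ (s / 2)) ^ 2 = (1 + freqSq L n) ^ s := fun n => by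
    rw [← Real.rpow_natCast, ← Real.rpow_mul (hpos n).le]; norm_num
  -- summation over the doubled index set
  have hdouble : ∀ f : (Fin 2 → ℤ) × Bool → ℝ, (∀ p, 0 ≤ f p) →
      Summable (fun n => f (n, true) + f (n, false)) →
      Summable f ∧ ∑' p, f p = ∑' n, (f (n, true) + f (n, false)) := by
    intro f hf h
    have hsum : Summable f := by
      rw [summable_prod_of_nonneg hf]
      refine ⟨fun n => Summable.of_finite, h.congr fun n => ?_⟩
      simp [tsum_fintype]
    refine ⟨hsum, ?_⟩
    rw [hsum.tsum_prod]
    refine tsum_congr fun n => ?_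
    simp [tsum_fintype]
  let part : Bool → ℂ → ℝ := fun b z => if b then z.re else z.im
  have hpart : ∀ z, part true z ^ 2 + part false z ^ 2 = ‖z‖ ^ 2 := fun z => by
    simp [part, Complex.sq_norm, Complex.normSq_apply]; ring
  have hSsum : ∀ φ : SmoothTorus L, Summable (fun p : (Fin 2 → ℤ) × Bool =>
        (L⁻¹ * (1 + freqSq L p.1) ^ (s / 2) * part p.2 (fourierCoef L φ p.1)) ^ 2) ∧
      ∑' p : (Fin 2 → ℤ) × Bool,
        (L⁻¹ * (1 + freqSq L p.1) ^ (s / 2) * part p.2 (fourierCoef L φ p.1)) ^ 2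
        = ‖toTest L s φ‖ ^ 2 := by
    intro φ
    have e : ∀ n, (L⁻¹ * (1 + freqSq L n) ^ (s / 2) * part true (fourierCoef L φ n)) ^ 2
        + (L⁻¹ * (1 + freqSq L n) ^ (s / 2) * part false (fourierCoef L φ n)) ^ 2
        = (L ^ 2)⁻¹ * ((1 + freqSq L n) ^ s * ‖fourierCoef L φ n‖ ^ 2) := by
      intro n
      rw [← hpart, ← hrt]
      ring
    have h := hdouble (fun p : (Fin 2 → ℤ) × Bool =>
        (L⁻¹ * (1 + freqSq L p.1) ^ (s / 2) * part p.2 (fourierCoef L φ p.1)) ^ 2)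
      (fun p => sq_nonneg _)
      (((summable_sobolev L s φ).mul_left (L ^ 2)⁻¹).congr fun n => (e n).symm)
    refine ⟨h.1, h.2.trans ?_⟩
    rw [norm_sq_toTest, ← tsum_mul_left]
    exact tsum_congr e
  -- the isometry of `H^s` into a real sequence space
  let S₀ : SmoothTorus L →ₗ[ℝ] lp (fun _ : (Fin 2 → ℤ) × Bool => ℝ) 2 :=
    { toFun := fun φ => ⟨fun p =>
        L⁻¹ * (1 + freqSq L p.1) ^ (s / 2) * part p.2 (fourierCoef L φ p.1), by
          refine (memℓp_gen_iff (by norm_num)).2 ?_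
          refine (hSsum φ).1.congr fun p => ?_
          simp [mul_pow]⟩
      map_add' := fun φ ψ => by
        ext p
        have h := fourierCoef_add L φ ψ p.1
        have h' : part p.2 (fourierCoef L φ p.1 + fourierCoef L ψ p.1)
            = part p.2 (fourierCoef L φ p.1) + part p.2 (fourierCoef L ψ p.1) := by
          simp only [part]; split_ifs <;> simp
        simp only [lp.coeFn_add, Pi.add_apply]
        rw [← mul_add, ← h', ← h]
      map_smul' := fun c φ => by
        ext p
        have h := fourierCoef_smul L c φ p.1
        have h' : part p.2 (c * fourierCoef L φ p.1) = c * part p.2 (fourierCoef L φ p.1) := by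
          simp only [part]; split_ifs <;> simp
        simp only [lp.coeFn_smul, Pi.smul_apply, RingHom.id_apply, smul_eq_mul]
        rw [mul_left_comm, ← h', ← h] }
  have hS₀ : ∀ φ, ‖S₀ φ‖ = ‖toTest L s φ‖ := by
    intro φ
    have h' := lp.norm_rpow_eq_tsum (p := 2) (by norm_num) (S₀ φ)
    simp only [ENNReal.toReal_ofNat, Real.rpow_ofNat] at h'
    have h2 : ‖S₀ φ‖ ^ 2 = ‖toTest L s φ‖ ^ 2 := by
      rw [h']
      refine Eq.trans (tsum_congr fun p => ?_) (hSsum φ).2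
      rw [Real.norm_eq_abs, sq_abs]
      rfl
    exact (sq_eq_sq₀ (norm_nonneg _) (norm_nonneg _)).1 h2
  let S : TestSpace L s →L[ℝ] lp (fun _ : (Fin 2 → ℤ) × Bool => ℝ) 2 :=
    (S₀ ∘ₗ (toTest L s).symm.toLinearMap).mkContinuous 1 fun φ => by
      rw [one_mul]
      exact (hS₀ _).le
  let T : lp (fun _ : (Fin 2 → ℤ) × Bool => ℝ) 2 →L[ℝ] NegSobolev L s :=
    ((ContinuousLinearMap.compL ℝ (TestSpace L s) (lp (fun _ : (Fin 2 → ℤ) × Bool => ℝ) 2) ℝ).flip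
      S).comp (innerSL ℝ)
  have hT : ∀ h φ, toDist (T h) φ = inner ℝ h (S₀ φ) := fun h φ => rfl
  let a : (Fin 2 → ℤ) × Bool → ℝ := fun p =>
    Real.sqrt ((1 + freqSq L p.1) ^ (-s) / (m ^ 2 + freqSq L p.1))
  have ha2 : ∀ p, a p ^ 2 = (1 + freqSq L p.1) ^ (-s) / (m ^ 2 + freqSq L p.1) := fun p =>
    Real.sq_sqrt (div_nonneg (Real.rpow_nonneg (hpos _).le _) (hmpos _).le)
  have ha : Summable fun p => a p ^ 2 := by
    refine (hdouble _ (fun p => sq_nonneg _) ?_).1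
    simp only [ha2]
    exact (summable_weight hL hs).add (summable_weight hL hs)
  obtain ⟨ν, hν⟩ := exists_gaussian_lp a ha
  have hTm : Measurable T := T.continuous.measurable
  have hev : ∀ φ : SmoothTorus L, Measurable fun Z : NegSobolev L s => toDist Z φ := fun φ =>
    (ContinuousLinearMap.apply ℝ ℝ (toTest L s φ)).continuous.measurable
  have hlaw : ∀ φ : SmoothTorus L, (ν.map T).map (fun Z => toDist Z φ)
      = gaussianReal 0 (massiveInner L m φ φ).toNNReal := by
    intro φ
    rw [Measure.map_map (hev φ) hTm]
    refine (hν (S₀ φ)).trans ?_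
    congr 2
    have e : ∀ p : (Fin 2 → ℤ) × Bool, a p ^ 2 * S₀ φ p ^ 2
        = (L ^ 2)⁻¹ * (part p.2 (fourierCoef L φ p.1) ^ 2 / (m ^ 2 + freqSq L p.1)) := by
      intro p
      have : S₀ φ p = L⁻¹ * (1 + freqSq L p.1) ^ (s / 2) * part p.2 (fourierCoef L φ p.1) := rfl
      rw [this, ha2, mul_pow, mul_pow, hrt, Real.rpow_neg (hpos _).le]
      have h1 := Real.rpow_pos_of_pos (hpos p.1) s
      field_simp
    have e2 : ∀ n, (L ^ 2)⁻¹ * (part true (fourierCoef L φ n) ^ 2 / (m ^ 2 + freqSq L n))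
        + (L ^ 2)⁻¹ * (part false (fourierCoef L φ n) ^ 2 / (m ^ 2 + freqSq L n))
        = (L ^ 2)⁻¹ * ((fourierCoef L φ n * starRingEnd ℂ (fourierCoef L φ n)).re /
          (m ^ 2 + freqSq L n)) := by
      intro n
      rw [← mul_add, ← add_div, hpart, Complex.mul_conj, Complex.ofReal_re, Complex.sq_norm]
    rw [tsum_congr e, massiveInner, ← tsum_mul_left]
    refine (hdouble _ (fun p => ?_) ?_).2.trans (tsum_congr e2)
    · have := hmpos p.1
      positivity
    · exact ((summable_massive L hm φ φ).mul_left (L ^ 2)⁻¹).congr fun n => (e2 n).symm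
  have hgauss : IsGaussian (ν.map T) := by
    refine isGaussian_of_map_eq_gaussianReal fun Λ => ?_
    rw [Measure.map_map Λ.continuous.measurable hTm]
    let u := (InnerProductSpace.toDual ℝ (lp (fun _ : (Fin 2 → ℤ) × Bool => ℝ) 2)).symm (Λ.comp T)
    have hu : (Λ ∘ T) = fun h => inner ℝ h u := by
      funext h
      rw [real_inner_comm, InnerProductSpace.toDual_symm_apply]
      rfl
    rw [hu]
    exact ⟨_, _, hν u⟩
  have hmean : ∀ φ : SmoothTorus L, ∫ Z, toDist Z φ ∂(ν.map T) = 0 := by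
    intro φ
    have := integral_id_gaussianReal (μ := 0) (v := (massiveInner L m φ φ).toNNReal)
    rwa [← hlaw φ, integral_map (hev φ).aemeasurable (by fun_prop)] at this
  have hmem : ∀ φ : SmoothTorus L, MemLp (fun Z => toDist Z φ) 2 (ν.map T) := by
    intro φ
    have := memLp_id_gaussianReal (μ := 0) (v := (massiveInner L m φ φ).toNNReal) 2
    rw [← hlaw φ] at this
    exact this.comp_of_map (hev φ).aemeasurable
  have hvar : ∀ φ : SmoothTorus L, ∫ Z, toDist Z φ ^ 2 ∂(ν.map T) = massiveInner L m φ φ := by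
    intro φ
    have := variance_id_gaussianReal (μ := 0) (v := (massiveInner L m φ φ).toNNReal)
    rw [variance_of_integral_eq_zero (by fun_prop) (by simp)] at this
    simp only [id] at this
    rw [← hlaw φ, integral_map (hev φ).aemeasurable (by fun_prop)] at this
    rw [this, Real.coe_toNNReal]
    refine mul_nonneg (by positivity) (tsum_nonneg fun n => div_nonneg ?_ (hmpos n).le)
    rw [Complex.mul_conj, Complex.ofReal_re]
    exact Complex.normSq_nonneg _
  refine ⟨ν.map T, hgauss, hmean, fun φ ψ => ?_⟩
  have h1 := hvar (φ + ψ)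
  rw [massiveInner_add_self L hm] at h1
  have h2 : ∫ Z, toDist Z (φ + ψ) ^ 2 ∂(ν.map T) = ∫ Z, toDist Z φ ^ 2 ∂(ν.map T)
      + ∫ Z, toDist Z ψ ^ 2 ∂(ν.map T) + 2 * ∫ Z, toDist Z φ * toDist Z ψ ∂(ν.map T) := by
    have i1 := (hmem φ).integrable_sq
    have i2 := (hmem ψ).integrable_sq
    have i3 : Integrable (fun Z => toDist Z φ * toDist Z ψ) (ν.map T) :=
      (hmem φ).integrable_mul (hmem ψ)
    rw [← integral_const_mul, ← integral_add i1 i2, 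
      ← integral_add (f := fun Z => toDist Z φ ^ 2 + toDist Z ψ ^ 2) (i1.add i2)
        (i3.const_mul 2)]
    refine integral_congr_ae (Eventually.of_forall fun Z => ?_)
    simp only [map_add]
    ring
  rw [h1, hvar φ, hvar ψ] at h2
  linarith

end TorusField

/-!
Both inequalities follow from Talagrand's transport inequality for a sequence of independent standard
Gaussian variables, some of which may be degenerate (`exists_coupling_of_gaussian_coordinates`).

*One variable.* Let `T` be the monotone map from the standard Gaussian `γ` to `ν`. If `ν` has a
continuous positive Lebesgue density, `T` is differentiable, and the change of variables turns
`H(ν | γ)` into `∫ (T y ^ 2 - y ^ 2) / 2 - log (T' y) dγ`. The bound `log T' ≤ T' - 1` and Gaussian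
integration by parts give `∫ (T y - y) ^ 2 dγ ≤ 2 H(ν | γ)`. A general `ν` is reached by smoothing
along the Ornstein-Uhlenbeck semigroup, which does not increase the entropy, and Fatou's lemma
(`lintegral_sq_monotoneTransport_le`).

*Many variables.* The chain rule for the entropy lets one transport coordinate by coordinate: given
the past, the next coordinate is moved by the monotone map onto its conditional law, and the costs add
up to at most twice the entropy. The resulting triangular map handles all coordinates at once
(`exists_transport_infinitePi`).

*From coordinates to fields.* A coupling of the images of two measures under a measurable map comes
from a coupling of the measures themselves, by gluing the conditional laws given the images
(`exists_coupling_of_coupling_map`), and the relative entropy does not increase under maps. Hence it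
suffices that the cost be a function of the coordinates; these need not separate points.

*Choice of coordinates.* In the spectral case they are `Φ.e_k / √λ_k`, and the cost is exactly the sum
of the squared differences. For the free field, the Gram-Schmidt process for the covariance form,
applied to a sequence of test functions that is dense in `H^s`, produces tests `b_k` for which the
`Z.b_k` are independent and standard Gaussian or zero (`exists_orthonormal_tests`). If
`Q = ∑ (Y.b_k) ^ 2` is finite, the Cauchy-Schwarz inequality on linear combinations of the `b_k`, and
then continuity, give `(Y.φ) ^ 2 ≤ Q ‖φ‖²` for every smooth `φ`, with `‖φ‖` the norm of `H^{-1}_m`.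
By the Hahn-Banach and Riesz theorems `Y` is then a function with distributional gradient in `L²`, and
`‖Y‖²_{H¹_m} ≤ Q` (`h1NormSq_le`).
-/

open MeasureTheory ProbabilityTheory InformationTheory Filter Topology Set
open scoped ENNReal NNReal

namespace GaussianTransport

/-! ### Monotone transport from the standard Gaussian on the line -/

/-- The standard Gaussian measure on the line. -/
noncomputable abbrev stdGaussian : Measure ℝ := gaussianReal 0 1

/-- The monotone rearrangement `F_ρ⁻¹ ∘ F_γ` of the standard Gaussian measure `γ` into `ρ`, with
`F_ρ⁻¹` the left-continuous quantile function. -/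
noncomputable def monotoneTransport (ρ : Measure ℝ) (y : ℝ) : ℝ :=
  sInf {x | cdf stdGaussian y ≤ cdf ρ x}

lemma continuous_cdf (ρ : Measure ℝ) [IsProbabilityMeasure ρ] [NullSingletonClass ρ] :
    Continuous (cdf ρ) := by
  refine continuous_iff_continuousAt.2 fun x => ?_
  rw [(cdf ρ).mono.continuousAt_iff_leftLim_eq_rightLim, (cdf ρ).rightLim_eq]
  have h := (cdf ρ).measure_singleton x
  rw [measure_cdf, measure_singleton, eq_comm, ENNReal.ofReal_eq_zero] at h
  exact le_antisymm ((cdf ρ).mono.leftLim_le le_rfl) (by linarith)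

instance : NullSingletonClass stdGaussian := nullSingletonClass_gaussianReal one_ne_zero

lemma strictMono_cdf_of_volume_absolutelyContinuous {ρ : Measure ℝ} [IsProbabilityMeasure ρ]
    (h : volume ≪ ρ) : StrictMono (cdf ρ) := by
  intro x y hxy
  have h1 := (cdf ρ).measure_Ioc x y
  rw [measure_cdf] at h1
  have h2 : ρ (Ioc x y) ≠ 0 := fun h0 => by
    have := h h0
    rw [Real.volume_Ioc, ENNReal.ofReal_eq_zero] at this
    linarith
  rw [h1, Ne, ENNReal.ofReal_eq_zero, not_le] at h2
  linarith

lemma strictMono_cdf_stdGaussian : StrictMono (cdf stdGaussian) :=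
  strictMono_cdf_of_volume_absolutelyContinuous (gaussianReal_absolutelyContinuous' 0 one_ne_zero)

lemma cdf_mem_Ioo {ρ : Measure ℝ} (h : StrictMono (cdf ρ)) (y : ℝ) : cdf ρ y ∈ Ioo (0 : ℝ) 1 :=
  ⟨(cdf_nonneg ρ (y - 1)).trans_lt (h (by linarith)),
    (h (by linarith : y < y + 1)).trans_le (cdf_le_one ρ _)⟩

lemma exists_cdf_eq {ρ : Measure ℝ} (h : Continuous (cdf ρ)) {u : ℝ} (hu : u ∈ Ioo (0 : ℝ) 1) :
    ∃ x, cdf ρ x = u := by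
  obtain ⟨a, ha⟩ := ((tendsto_cdf_atBot ρ).eventually_lt_const hu.1).exists
  obtain ⟨b, hb⟩ := ((tendsto_cdf_atTop ρ).eventually_const_lt hu.2).exists
  exact mem_range_of_exists_le_of_exists_ge h ⟨a, ha.le⟩ ⟨b, hb.le⟩

/-- The Galois connection characterizing the quantile function. -/
lemma monotoneTransport_le_iff (ρ : Measure ℝ) (y x : ℝ) :
    monotoneTransport ρ y ≤ x ↔ cdf stdGaussian y ≤ cdf ρ x := by
  obtain ⟨h0, h1⟩ := cdf_mem_Ioo strictMono_cdf_stdGaussian y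
  obtain ⟨a, ha⟩ := ((tendsto_cdf_atBot ρ).eventually_lt_const h0).exists
  obtain ⟨b, hb⟩ := ((tendsto_cdf_atTop ρ).eventually_const_lt h1).exists
  have hbdd : BddBelow {x | cdf stdGaussian y ≤ cdf ρ x} :=
    ⟨a, fun z hz => le_of_lt ((monotone_cdf ρ).reflect_lt (ha.trans_le hz))⟩
  refine ⟨fun h => ?_, fun h => csInf_le hbdd h⟩
  refine le_trans ?_ (monotone_cdf ρ h)
  have hright : Tendsto (cdf ρ) (𝓝[>] monotoneTransport ρ y)
      (𝓝 (cdf ρ (monotoneTransport ρ y))) :=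
    ((cdf ρ).right_continuous _).mono_left (nhdsWithin_mono _ Ioi_subset_Ici_self)
  refine ge_of_tendsto hright ?_
  filter_upwards [self_mem_nhdsWithin] with z hz
  obtain ⟨w, hw, hwz⟩ := exists_lt_of_csInf_lt ⟨b, hb.le⟩ hz
  exact le_trans hw (monotone_cdf ρ hwz.le)

lemma monotone_monotoneTransport (ρ : Measure ℝ) : Monotone (monotoneTransport ρ) := by
  intro y z hyz
  rw [monotoneTransport_le_iff]
  exact (monotone_cdf _ hyz).trans ((monotoneTransport_le_iff ρ z _).1 le_rfl)

lemma stdGaussian_setOf_cdf_le {u : ℝ} (h0 : 0 ≤ u) (h1 : u ≤ 1) :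
    stdGaussian {y | cdf stdGaussian y ≤ u} = ENNReal.ofReal u := by
  rcases h0.eq_or_lt with rfl | h0
  · have : {y | cdf stdGaussian y ≤ 0} = ∅ := by
      ext y
      simpa using (cdf_mem_Ioo strictMono_cdf_stdGaussian y).1
    simp [this]
  rcases h1.eq_or_lt with rfl | h1
  · simp [cdf_le_one]
  obtain ⟨z, rfl⟩ := exists_cdf_eq (continuous_cdf stdGaussian) ⟨h0, h1⟩
  simp only [strictMono_cdf_stdGaussian.le_iff_le]
  exact (ofReal_cdf stdGaussian z).symm

lemma map_monotoneTransport (ρ : Measure ℝ) [IsProbabilityMeasure ρ] :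
    stdGaussian.map (monotoneTransport ρ) = ρ := by
  have hm := (monotone_monotoneTransport ρ).measurable
  refine Measure.ext_of_Iic _ _ fun x => ?_
  rw [Measure.map_apply hm measurableSet_Iic, ← ofReal_cdf,
    ← stdGaussian_setOf_cdf_le (cdf_nonneg ρ x) (cdf_le_one ρ x)]
  congr 1
  ext y
  exact monotoneTransport_le_iff ρ y x

/-! ### The transport map onto a continuous positive density -/

section Smooth

variable {ρ : Measure ℝ} [IsProbabilityMeasure ρ] {q : ℝ → ℝ}

lemma hasDerivAt_cdf (hρ : ρ = volume.withDensity fun x => ENNReal.ofReal (q x))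
    (hq : Continuous q) (hpos : ∀ x, 0 < q x) (x : ℝ) : HasDerivAt (cdf ρ) (q x) x := by
  have h : ∀ y, cdf ρ y = cdf ρ x + ∫ t in x..y, q t := by
    have key : ∀ a b, a ≤ b → ∫ t in a..b, q t = cdf ρ b - cdf ρ a := by
      intro a b hab
      have h1 := (cdf ρ).measure_Ioc a b
      rw [measure_cdf] at h1
      nth_rewrite 1 [hρ] at h1
      rw [withDensity_apply _ measurableSet_Ioc, ← ofReal_integral_eq_lintegral_ofReal
        (hq.integrableOn_Ioc) (ae_of_all _ fun t => (hpos t).le)] at h1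
      rw [intervalIntegral.integral_of_le hab]
      refine (ENNReal.ofReal_eq_ofReal_iff (integral_nonneg fun t => (hpos t).le)
        (sub_nonneg.2 (monotone_cdf ρ hab))).1 h1
    intro y
    rcases le_total x y with hxy | hxy
    · rw [key x y hxy]; ring
    · rw [intervalIntegral.integral_symm, key y x hxy]; ring
  rw [show ⇑(cdf ρ) = fun y => cdf ρ x + ∫ t in x..y, q t from funext h]
  exact (intervalIntegral.integral_hasDerivAt_right (hq.intervalIntegrable _ _)
    (hq.stronglyMeasurableAtFilter _ _) hq.continuousAt).const_add _

lemma hasDerivAt_cdf_stdGaussian (x : ℝ) :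
    HasDerivAt (cdf stdGaussian) (gaussianPDFReal 0 1 x) x :=
  hasDerivAt_cdf (gaussianReal_of_var_ne_zero 0 one_ne_zero)
    (by rw [gaussianPDFReal_def]; fun_prop) (fun x => gaussianPDFReal_pos 0 1 x one_ne_zero) x

lemma continuous_gaussianPDFReal (m : ℝ) (v : ℝ≥0) : Continuous (gaussianPDFReal m v) := by
  rw [gaussianPDFReal_def]; fun_prop

lemma hasDerivAt_gaussianPDFReal (y : ℝ) :
    HasDerivAt (gaussianPDFReal 0 1) (-y * gaussianPDFReal 0 1 y) y := by
  rw [gaussianPDFReal_def]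
  have h : HasDerivAt (fun x : ℝ => -(x - 0) ^ 2 / (2 * ((1 : ℝ≥0) : ℝ))) (-y) y := by
    have := (((hasDerivAt_id y).sub_const 0).pow 2).neg.div_const (2 * ((1 : ℝ≥0) : ℝ))
    refine this.congr_deriv ?_
    simp
    ring
  refine (h.exp.const_mul _).congr_deriv ?_
  ring

lemma strictMono_cdf_of_pos (hρ : ρ = volume.withDensity fun x => ENNReal.ofReal (q x))
    (hq : Continuous q) (hpos : ∀ x, 0 < q x) : StrictMono (cdf ρ) :=
  strictMono_of_deriv_pos fun x => by rw [(hasDerivAt_cdf hρ hq hpos x).deriv]; exact hpos x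

lemma cdf_monotoneTransport (hρ : ρ = volume.withDensity fun x => ENNReal.ofReal (q x))
    (hq : Continuous q) (hpos : ∀ x, 0 < q x) (y : ℝ) :
    cdf ρ (monotoneTransport ρ y) = cdf stdGaussian y := by
  have hc : Continuous (cdf ρ) :=
    continuous_iff_continuousAt.2 fun x => (hasDerivAt_cdf hρ hq hpos x).continuousAt
  obtain ⟨x, hx⟩ := exists_cdf_eq hc (cdf_mem_Ioo strictMono_cdf_stdGaussian y)
  refine le_antisymm ?_ ((monotoneTransport_le_iff ρ y _).1 le_rfl)
  rw [← hx]
  exact monotone_cdf ρ ((monotoneTransport_le_iff ρ y x).2 hx.ge)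

lemma continuous_monotoneTransport (hρ : ρ = volume.withDensity fun x => ENNReal.ofReal (q x))
    (hq : Continuous q) (hpos : ∀ x, 0 < q x) : Continuous (monotoneTransport ρ) := by
  refine (monotone_monotoneTransport ρ).continuous_of_surjective fun x => ?_
  obtain ⟨y, hy⟩ := exists_cdf_eq (continuous_cdf stdGaussian)
    (cdf_mem_Ioo (strictMono_cdf_of_pos hρ hq hpos) x)
  refine ⟨y, (strictMono_cdf_of_pos hρ hq hpos).injective ?_⟩
  rw [cdf_monotoneTransport hρ hq hpos, hy]

/-- The Monge-Ampère equation `T' q(T) = φ` on the line. -/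
lemma hasDerivAt_monotoneTransport
    (hρ : ρ = volume.withDensity fun x => ENNReal.ofReal (q x))
    (hq : Continuous q) (hpos : ∀ x, 0 < q x) (y : ℝ) :
    HasDerivAt (monotoneTransport ρ)
      (gaussianPDFReal 0 1 y / q (monotoneTransport ρ y)) y := by
  have hmono := strictMono_cdf_of_pos hρ hq hpos
  have hT := continuous_monotoneTransport hρ hq hpos
  -- `F_ρ` has an inverse near `F_ρ (T y)`; `T` is that inverse after `F_γ`
  have hF := hasDerivAt_cdf hρ hq hpos (monotoneTransport ρ y)
  have hφ := hasDerivAt_cdf_stdGaussian y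
  rw [hasDerivAt_iff_tendsto_slope] at hF hφ ⊢
  have hinj : Function.Injective (monotoneTransport ρ) := fun a b hab => by
    have := cdf_monotoneTransport hρ hq hpos a
    rw [hab, cdf_monotoneTransport hρ hq hpos b] at this
    exact strictMono_cdf_stdGaussian.injective this.symm
  have hT' : Tendsto (monotoneTransport ρ) (𝓝[≠] y) (𝓝[≠] (monotoneTransport ρ y)) :=
    tendsto_nhdsWithin_of_tendsto_nhds_of_eventually_within _
      (hT.continuousAt.tendsto.mono_left nhdsWithin_le_nhds)
      (by filter_upwards [self_mem_nhdsWithin] with z hz using hinj.ne hz)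
  refine (hφ.div (hF.comp hT') (hpos _).ne').congr' ?_
  filter_upwards [self_mem_nhdsWithin] with z hz
  have h1 : monotoneTransport ρ z - monotoneTransport ρ y ≠ 0 := sub_ne_zero.2 (hinj.ne hz)
  have h2 : cdf stdGaussian z - cdf stdGaussian y ≠ 0 :=
    sub_ne_zero.2 (strictMono_cdf_stdGaussian.injective.ne hz)
  simp only [Function.comp, slope_def_field, cdf_monotoneTransport hρ hq hpos, Pi.div_apply]
  field_simp

end Smooth

/-! ### Talagrand's inequality on the line -/

lemma exists_seq_tendsto_atTop_of_integrable {G : ℝ → ℝ} (hG : Integrable G) :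
    ∃ b : ℕ → ℝ, Tendsto b atTop atTop ∧ Tendsto (fun n => G (b n)) atTop (𝓝 0) := by
  have h : ∀ n : ℕ, ∃ b : ℝ, (n : ℝ) ≤ b ∧ ‖G b‖ ≤ 1 / ((n : ℝ) + 1) := by
    intro n
    by_contra! hcon
    have h1 := hG.measure_norm_gt_lt_top (ε := 1 / ((n : ℝ) + 1)) (by positivity)
    have h2 : Ici (n : ℝ) ⊆ {a | 1 / ((n : ℝ) + 1) < ‖G a‖} := fun b hb => hcon b hb
    have h3 := (measure_mono h2).trans_lt h1
    simp at h3
  choose b hb hGb using h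
  exact ⟨b, tendsto_atTop_mono hb tendsto_natCast_atTop_atTop,
    squeeze_zero_norm hGb tendsto_one_div_add_atTop_nhds_zero_nat⟩

/-- Young's inequality for the conjugate functions `x log x - x + 1` and `exp t - 1`. -/
lemma mul_le_klFun_add_exp {a : ℝ} (ha : 0 ≤ a) (t : ℝ) : a * t ≤ klFun a + Real.exp t := by
  rcases ha.eq_or_lt with rfl | ha
  · have := Real.exp_pos t
    simp [klFun]; linarith
  · have h := Real.add_one_le_exp (t - Real.log a)
    rw [Real.exp_sub, Real.exp_log ha, le_div_iff₀ ha] at h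
    rw [klFun]
    nlinarith

lemma integrable_exp_sq_stdGaussian :
    Integrable (fun x => Real.exp (x ^ 2 / 4)) stdGaussian := by
  rw [stdGaussian, gaussianReal_of_var_ne_zero 0 one_ne_zero,
    integrable_withDensity_iff (measurable_gaussianPDF 0 1) (ae_of_all _ fun x =>
      gaussianPDF_lt_top)]
  refine ((integrable_exp_neg_mul_sq (b := 1 / 4) (by norm_num)).mul_const
    (√(2 * Real.pi * (1 : ℝ≥0)))⁻¹).congr (ae_of_all _ fun x => ?_)
  simp only [toReal_gaussianPDF, gaussianPDFReal]
  rw [mul_comm (√(2 * Real.pi * (1 : ℝ≥0)))⁻¹, ← mul_assoc, ← Real.exp_add]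
  congr 2
  simp
  ring

/-- Finite entropy with respect to the Gaussian measure forces a finite second moment. -/
lemma integrable_sq_of_klDiv_ne_top {ρ : Measure ℝ} [IsProbabilityMeasure ρ]
    (h : klDiv ρ stdGaussian ≠ ∞) : Integrable (fun x => x ^ 2) ρ := by
  obtain ⟨hac, hint⟩ := klDiv_ne_top_iff.1 h
  have hkl : Integrable (fun x => klFun (ρ.rnDeriv stdGaussian x).toReal) stdGaussian :=
    (integrable_klFun_rnDeriv_iff hac).2 hint
  have h1 : Integrable (fun x => (ρ.rnDeriv stdGaussian x).toReal • (x ^ 2 / 4)) stdGaussian := by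
    refine (hkl.add integrable_exp_sq_stdGaussian).mono' (by fun_prop) (ae_of_all _ fun x => ?_)
    have hp : 0 ≤ (ρ.rnDeriv stdGaussian x).toReal • (x ^ 2 / 4) := by
      rw [smul_eq_mul]; positivity
    rw [Real.norm_of_nonneg hp]
    exact mul_le_klFun_add_exp ENNReal.toReal_nonneg _
  rw [integrable_rnDeriv_smul_iff hac] at h1
  refine (h1.const_mul 4).congr (ae_of_all _ fun x => ?_)
  simp only
  ring

lemma llr_stdGaussian_ae_eq {ρ : Measure ℝ} {q : ℝ → ℝ}
    (hρ : ρ = volume.withDensity fun x => ENNReal.ofReal (q x))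
    (hq : Continuous q) (hpos : ∀ x, 0 < q x) :
    llr ρ stdGaussian =ᵐ[ρ] fun x => Real.log (q x) - Real.log (gaussianPDFReal 0 1 x) := by
  have hφ : ∀ x, 0 < gaussianPDFReal 0 1 x := fun x => gaussianPDFReal_pos 0 1 x one_ne_zero
  have hφm : Measurable (gaussianPDFReal 0 1) := measurable_gaussianPDFReal 0 1
  have hρ' : ρ = stdGaussian.withDensity
      fun x => ENNReal.ofReal (q x / gaussianPDFReal 0 1 x) := by
    rw [stdGaussian, gaussianReal_of_var_ne_zero 0 one_ne_zero,
      ← withDensity_mul _ (measurable_gaussianPDF 0 1) (by fun_prop), hρ]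
    congr 1
    ext x
    rw [Pi.mul_apply, gaussianPDF, ← ENNReal.ofReal_mul (hφ x).le,
      mul_div_cancel₀ _ (hφ x).ne']
  have hac : ρ ≪ stdGaussian := hρ' ▸ withDensity_absolutelyContinuous _ _
  have h := Measure.rnDeriv_withDensity stdGaussian
    (f := fun x => ENNReal.ofReal (q x / gaussianPDFReal 0 1 x)) (by fun_prop)
  rw [← hρ'] at h
  filter_upwards [hac.ae_le h] with x hx
  rw [llr, hx, ENNReal.toReal_ofReal (div_pos (hpos x) (hφ x)).le,
    Real.log_div (hpos x).ne' (hφ x).ne']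

/-- Talagrand's inequality for a continuous positive density. The change of variables turns the
entropy into `∫ (T² - y²) / 2 - log T' dγ`; bounding `log T' ≤ T' - 1` leaves the transport cost and
the derivative of `(T - y) φ`, which integrates to zero. -/
lemma lintegral_sq_monotoneTransport_le_of_density {ρ : Measure ℝ}
    [IsProbabilityMeasure ρ] {q : ℝ → ℝ}
    (hρ : ρ = volume.withDensity fun x => ENNReal.ofReal (q x))
    (hq : Continuous q) (hpos : ∀ x, 0 < q x) (hfin : klDiv ρ stdGaussian ≠ ∞) :
    ∫⁻ y, ENNReal.ofReal ((monotoneTransport ρ y - y) ^ 2) ∂stdGaussian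
      ≤ 2 * klDiv ρ stdGaussian := by
  set T := monotoneTransport ρ with hT
  set φ := gaussianPDFReal 0 1 with hφ
  obtain ⟨hac, hint⟩ := klDiv_ne_top_iff.1 hfin
  have hTc : Continuous T := continuous_monotoneTransport hρ hq hpos
  have hmap : stdGaussian.map T = ρ := map_monotoneTransport ρ
  have hφc : Continuous φ := continuous_gaussianPDFReal 0 1
  have hφpos : ∀ y, 0 < φ y := fun y => gaussianPDFReal_pos 0 1 y one_ne_zero
  have htoReal : ∀ x, (gaussianPDF 0 1 x).toReal = φ x := fun x => toReal_gaussianPDF x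
  have hlog : ∀ y, Real.log (φ y) = Real.log (√(2 * Real.pi * (1 : ℝ≥0)))⁻¹ - y ^ 2 / 2 := by
    intro y
    rw [hφ, gaussianPDFReal, Real.log_mul (by positivity) (Real.exp_pos _).ne', Real.log_exp]
    simp
    ring
  have hwd : ∀ f : ℝ → ℝ, Integrable f stdGaussian ↔ Integrable fun y => f y * φ y := by
    intro f
    rw [stdGaussian, gaussianReal_of_var_ne_zero 0 one_ne_zero, integrable_withDensity_iff
      (measurable_gaussianPDF 0 1) (ae_of_all _ fun x => gaussianPDF_lt_top)]
    simp only [htoReal]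
  have hwi : ∀ f : ℝ → ℝ, ∫ y, f y ∂stdGaussian = ∫ y, f y * φ y := by
    intro f
    rw [integral_gaussianReal_eq_integral_smul one_ne_zero]
    simp only [smul_eq_mul, mul_comm (f _), hφ]
  -- square integrability of `T - y`
  have hT2 : MemLp T 2 stdGaussian := by
    rw [memLp_two_iff_integrable_sq hTc.aestronglyMeasurable]
    have := integrable_sq_of_klDiv_ne_top hfin
    rw [← hmap, integrable_map_measure (by fun_prop) hTc.aemeasurable] at this
    exact this
  have hd2 : MemLp (fun y => T y - y) 2 stdGaussian :=
    hT2.sub (memLp_id_gaussianReal (μ := 0) (v := 1) 2)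
  have hsq : Integrable (fun y => (T y - y) ^ 2) stdGaussian := hd2.integrable_sq
  have hd1 : Integrable (fun y => T y - y) stdGaussian := hd2.integrable (by norm_num)
  -- the entropy after the change of variables
  set h : ℝ → ℝ := fun y => Real.log (q (T y)) - Real.log (φ (T y)) with hh
  have hllr := llr_stdGaussian_ae_eq hρ hq hpos
  have hlm : Measurable fun x => Real.log (q x) - Real.log (φ x) := by
    have := hφc.measurable
    fun_prop
  have hhint : Integrable h stdGaussian := by
    have := hint.congr hllr
    rw [← hmap, integrable_map_measure hlm.aestronglyMeasurable hTc.aemeasurable] at this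
    exact this
  have hent : (klDiv ρ stdGaussian).toReal = ∫ y, h y ∂stdGaussian := by
    rw [toReal_klDiv_of_measure_eq hac (by simp), integral_congr_ae hllr, ← hmap,
      integral_map hTc.aemeasurable hlm.aestronglyMeasurable]
  -- the boundary term
  set G : ℝ → ℝ := fun y => (T y - y) * φ y with hG
  set G' : ℝ → ℝ := fun y => (φ y / q (T y) - 1) * φ y + (T y - y) * (-y * φ y) with hG'
  have hGd : ∀ y, HasDerivAt G (G' y) y := fun y =>
    ((hasDerivAt_monotoneTransport hρ hq hpos y).sub (hasDerivAt_id y)).mul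
      (hasDerivAt_gaussianPDFReal y)
  have hG'c : Continuous G' := by
    have : Continuous fun y => φ y / q (T y) := hφc.div (hq.comp hTc) fun y => (hpos _).ne'
    fun_prop
  have hpt : ∀ y, (T y - y) ^ 2 * φ y - 2 * G' y ≤ 2 * (h y * φ y) := by
    intro y
    have hr : 0 < φ y / q (T y) := div_pos (hφpos y) (hpos _)
    have h1 := Real.log_le_sub_one_of_pos hr
    rw [Real.log_div (hφpos y).ne' (hpos _).ne', hlog] at h1
    have h2 : (T y - y) ^ 2 - 2 * ((φ y / q (T y) - 1) - y * (T y - y)) ≤ 2 * h y := by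
      simp only [hh, hlog]
      nlinarith
    have := mul_le_mul_of_nonneg_right h2 (hφpos y).le
    simp only [hG']
    nlinarith
  have hGint : Integrable G := (hwd _).1 hd1
  obtain ⟨b, hb, hGb⟩ := exists_seq_tendsto_atTop_of_integrable hGint
  obtain ⟨a, ha, hGa⟩ := exists_seq_tendsto_atTop_of_integrable hGint.comp_neg
  have hsqv := (hwd _).1 hsq
  have hhv := (hwd _).1 hhint
  have hlim1 := intervalIntegral_tendsto_integral hsqv (tendsto_neg_atTop_atBot.comp ha) hb
  have hlim2 := intervalIntegral_tendsto_integral hhv (tendsto_neg_atTop_atBot.comp ha) hb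
  have hle : ∫ y, (T y - y) ^ 2 ∂stdGaussian ≤ 2 * (klDiv ρ stdGaussian).toReal := by
    rw [hent, hwi, hwi]
    have hlim3 := hlim1.sub ((hGb.sub hGa).const_mul 2)
    rw [sub_zero, mul_zero, sub_zero] at hlim3
    refine le_of_tendsto_of_tendsto hlim3 (hlim2.const_mul 2) ?_
    filter_upwards [ha.eventually_ge_atTop 0, hb.eventually_ge_atTop 0] with n han hbn
    simp only [Function.comp]
    rw [← intervalIntegral.integral_eq_sub_of_hasDerivAt (fun y _ => hGd y)
      (hG'c.intervalIntegrable _ _), ← intervalIntegral.integral_const_mul,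
      ← intervalIntegral.integral_const_mul, ← intervalIntegral.integral_sub
        hsqv.intervalIntegrable ((hG'c.const_mul 2).intervalIntegrable _ _)]
    exact intervalIntegral.integral_mono (by linarith)
      (hsqv.intervalIntegrable.sub ((hG'c.const_mul 2).intervalIntegrable _ _))
      (hhv.intervalIntegrable.const_mul 2) hpt
  rw [← ofReal_integral_eq_lintegral_ofReal hsq (ae_of_all _ fun y => sq_nonneg _),
    ← ENNReal.ofReal_toReal hfin, show (2 : ℝ≥0∞) = ENNReal.ofReal 2 by simp,
    ← ENNReal.ofReal_mul (by norm_num)]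
  exact ENNReal.ofReal_le_ofReal hle

/-! ### Ornstein-Uhlenbeck smoothing -/

/-- The law of `c X + s G` for independent `X ~ ρ` and a standard Gaussian `G`. -/
noncomputable def ouSmoothing (c s : ℝ) (ρ : Measure ℝ) : Measure ℝ :=
  (ρ.prod stdGaussian).map fun p => c * p.1 + s * p.2

instance (c s : ℝ) (ρ : Measure ℝ) [IsProbabilityMeasure ρ] :
    IsProbabilityMeasure (ouSmoothing c s ρ) :=
  Measure.isProbabilityMeasure_map (by fun_prop)

lemma ouSmoothing_stdGaussian {c s : ℝ} (hcs : c ^ 2 + s ^ 2 = 1) :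
    ouSmoothing c s stdGaussian = stdGaussian := by
  have h : ouSmoothing c s stdGaussian
      = (stdGaussian.map (c * ·)) ∗ (stdGaussian.map (s * ·)) := by
    rw [ouSmoothing, Measure.conv, Measure.map_prod_map _ _ (by fun_prop) (by fun_prop),
      Measure.map_map (by fun_prop) (by fun_prop)]
    rfl
  rw [h, gaussianReal_map_const_mul, gaussianReal_map_const_mul, gaussianReal_conv_gaussianReal]
  congr 1
  · simp
  · ext
    simpa using hcs

lemma klDiv_ouSmoothing_le {c s : ℝ} (hcs : c ^ 2 + s ^ 2 = 1) (ρ : Measure ℝ)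
    [IsProbabilityMeasure ρ] :
    klDiv (ouSmoothing c s ρ) stdGaussian ≤ klDiv ρ stdGaussian := by
  nth_rewrite 1 [← ouSmoothing_stdGaussian hcs]
  refine (klDiv_map_le _ _ (by fun_prop)).trans ?_
  rw [← Measure.compProd_const, ← Measure.compProd_const, klDiv_compProd_left]

/-- The density of `c X + s G` with respect to Lebesgue measure. -/
noncomputable def ouDensity (c s : ℝ) (ρ : Measure ℝ) (x : ℝ) : ℝ :=
  ∫ y, gaussianPDFReal (c * y) (Real.toNNReal (s ^ 2)) x ∂ρ

lemma gaussianPDFReal_le (m : ℝ) (v : ℝ≥0) (x : ℝ) :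
    gaussianPDFReal m v x ≤ (√(2 * Real.pi * v))⁻¹ := by
  rw [gaussianPDFReal]
  refine mul_le_of_le_one_right (by positivity) (Real.exp_le_one_iff.2 ?_)
  exact div_nonpos_of_nonpos_of_nonneg (by nlinarith [sq_nonneg (x - m)]) (by positivity)

section Density

variable {c s : ℝ} {ρ : Measure ℝ} [IsProbabilityMeasure ρ]

lemma integrable_gaussianPDFReal_mul (c s : ℝ) (ρ : Measure ℝ) [IsProbabilityMeasure ρ] (x : ℝ) :
    Integrable (fun y => gaussianPDFReal (c * y) (Real.toNNReal (s ^ 2)) x) ρ := by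
  refine Integrable.of_bound (C := (√(2 * Real.pi * (Real.toNNReal (s ^ 2))))⁻¹) ?_
    (ae_of_all _ fun y => ?_)
  · unfold gaussianPDFReal
    fun_prop
  · rw [Real.norm_of_nonneg (gaussianPDFReal_nonneg _ _ _)]
    exact gaussianPDFReal_le _ _ _

lemma ouSmoothing_eq_withDensity (hs : 0 < s) :
    ouSmoothing c s ρ = volume.withDensity fun x => ENNReal.ofReal (ouDensity c s ρ x) := by
  have hv : Real.toNNReal (s ^ 2) ≠ 0 := by simpa using hs.ne'
  ext A hA
  rw [withDensity_apply _ hA, ouSmoothing, Measure.map_apply (by fun_prop) hA,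
    Measure.prod_apply (by measurability)]
  have h1 : ∀ y : ℝ, stdGaussian (Prod.mk y ⁻¹' ((fun p : ℝ × ℝ => c * p.1 + s * p.2) ⁻¹' A))
      = ∫⁻ x in A, gaussianPDF (c * y) (Real.toNNReal (s ^ 2)) x := by
    intro y
    rw [← gaussianReal_apply _ hv]
    have : gaussianReal (c * y) (Real.toNNReal (s ^ 2))
        = stdGaussian.map fun g => c * y + s * g := by
      rw [show (fun g : ℝ => c * y + s * g) = (fun g => c * y + g) ∘ (fun g => s * g) from rfl,
        ← Measure.map_map (by fun_prop) (by fun_prop), gaussianReal_map_const_mul,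
        gaussianReal_map_const_add]
      congr 1
      · simp
      · ext; simp [sq_nonneg]
    rw [this, Measure.map_apply (by fun_prop) hA]
    rfl
  simp_rw [h1]
  rw [lintegral_lintegral_swap]
  · refine lintegral_congr fun x => ?_
    rw [ouDensity, ofReal_integral_eq_lintegral_ofReal (integrable_gaussianPDFReal_mul c s ρ x)
      (ae_of_all _ fun y => gaussianPDFReal_nonneg _ _ _)]
    rfl
  · refine Measurable.aemeasurable ?_
    simp only [Function.uncurry_def, gaussianPDF, gaussianPDFReal]
    fun_prop

lemma continuous_ouDensity : Continuous (ouDensity c s ρ) := by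
  refine continuous_of_dominated (bound := fun _ => (√(2 * Real.pi * (Real.toNNReal (s ^ 2))))⁻¹)
    (fun x => (integrable_gaussianPDFReal_mul c s ρ x).aestronglyMeasurable)
    (fun x => ae_of_all _ fun y => ?_) (integrable_const _)
    (ae_of_all _ fun y => continuous_gaussianPDFReal _ _)
  rw [Real.norm_of_nonneg (gaussianPDFReal_nonneg _ _ _)]
  exact gaussianPDFReal_le _ _ _

lemma ouDensity_pos (hs : 0 < s) (x : ℝ) : 0 < ouDensity c s ρ x := by
  have hv : Real.toNNReal (s ^ 2) ≠ 0 := by simpa using hs.ne'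
  rw [ouDensity, integral_pos_iff_support_of_nonneg (fun y => gaussianPDFReal_nonneg _ _ _)
    (integrable_gaussianPDFReal_mul c s ρ x)]
  have : Function.support (fun y => gaussianPDFReal (c * y) (Real.toNNReal (s ^ 2)) x) = univ :=
    eq_univ_of_forall fun y => (gaussianPDFReal_pos _ _ _ hv).ne'
  simp [this]

end Density

lemma tendsto_cdf_ouSmoothing {ρ : Measure ℝ} [IsProbabilityMeasure ρ] {x : ℝ} (hx : ρ {x} = 0)
    {c s : ℕ → ℝ} (hc : Tendsto c atTop (𝓝 1)) (hs : Tendsto s atTop (𝓝 0)) :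
    Tendsto (fun n => cdf (ouSmoothing (c n) (s n) ρ) x) atTop (𝓝 (cdf ρ x)) := by
  have h1 : ∀ n, cdf (ouSmoothing (c n) (s n) ρ) x = ∫ p,
      (Iic x).indicator (fun _ => (1 : ℝ)) (c n * p.1 + s n * p.2) ∂(ρ.prod stdGaussian) := by
    intro n
    rw [cdf_eq_real, ouSmoothing, map_measureReal_apply (by fun_prop) measurableSet_Iic,
      ← integral_indicator_one ((measurableSet_Iic (a := x)).preimage (by fun_prop))]
    rfl
  have h2 : cdf ρ x = ∫ p, (Iic x).indicator (fun _ => (1 : ℝ)) p.1 ∂(ρ.prod stdGaussian) := by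
    rw [cdf_eq_real, integral_fun_fst (f := (Iic x).indicator fun _ => (1 : ℝ)),
      integral_indicator_const _ measurableSet_Iic]
    simp
  simp_rw [h1]
  rw [h2]
  have hne : ∀ᵐ p ∂(ρ.prod stdGaussian), p.1 ≠ x := by
    have : ∀ᵐ z ∂ρ, z ≠ x := by simpa [ae_iff] using hx
    exact (Measure.quasiMeasurePreserving_fst (μ := ρ) (ν := stdGaussian)).ae this
  have hind : Measurable ((Iic x).indicator fun _ => (1 : ℝ)) :=
    measurable_const.indicator measurableSet_Iic
  refine tendsto_integral_of_dominated_convergence (fun _ => 1)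
    (fun n => (hind.comp (by fun_prop)).aestronglyMeasurable) (by simp)
    (fun n => ae_of_all _ fun p => ?_) ?_
  · by_cases h : c n * p.1 + s n * p.2 ∈ Iic x <;> simp [indicator, h]
  · filter_upwards [hne] with p hp
    have ht : Tendsto (fun n => c n * p.1 + s n * p.2) atTop (𝓝 p.1) := by
      simpa using (hc.mul_const p.1).add (hs.mul_const p.2)
    refine tendsto_const_nhds.congr' ?_
    rcases lt_or_gt_of_ne hp with h | h
    · filter_upwards [ht.eventually_lt_const h] with n hn
      rw [indicator_of_mem (mem_Iic.2 h.le), indicator_of_mem (mem_Iic.2 hn.le)]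
    · filter_upwards [ht.eventually_const_lt h] with n hn
      rw [indicator_of_notMem (by simpa using h), indicator_of_notMem (by simpa using hn)]

lemma tendsto_monotoneTransport {ρ : Measure ℝ} {ρs : ℕ → Measure ℝ}
    (h : ∀ x, Tendsto (fun n => cdf (ρs n) x) atTop (𝓝 (cdf ρ x))) {y : ℝ}
    (hy : ContinuousAt (monotoneTransport ρ) y) :
    Tendsto (fun n => monotoneTransport (ρs n) y) atTop (𝓝 (monotoneTransport ρ y)) := by
  refine tendsto_order.2 ⟨fun a ha => ?_, fun a ha => ?_⟩
  · obtain ⟨x, hax, hx⟩ := exists_between ha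
    have hlt : cdf ρ x < cdf stdGaussian y := by
      rw [← not_le, ← monotoneTransport_le_iff, not_le]; exact hx
    filter_upwards [(h x).eventually_lt_const hlt] with n hn
    refine hax.trans ?_
    rw [← not_le, monotoneTransport_le_iff, not_le]
    exact hn
  · obtain ⟨x, hx, hxa⟩ := exists_between ha
    -- a point `z > y` with `T z < x`
    obtain ⟨z, hzx, hyz⟩ : ∃ z, monotoneTransport ρ z < x ∧ y < z :=
      (((hy.eventually_lt_const hx).filter_mono nhdsWithin_le_nhds).and
        (self_mem_nhdsWithin (s := Ioi y))).exists
    have hlt : cdf stdGaussian y < cdf ρ x :=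
      (strictMono_cdf_stdGaussian hyz).trans_le ((monotoneTransport_le_iff ρ z x).1 hzx.le)
    filter_upwards [(h x).eventually_const_lt hlt] with n hn
    exact ((monotoneTransport_le_iff _ _ _).2 hn.le).trans_lt hxa

/-- **Talagrand's inequality on the line**, for the monotone transport map. Smoothing along the
Ornstein-Uhlenbeck semigroup decreases the entropy and makes the density continuous and positive;
Fatou's lemma removes it. -/
theorem lintegral_sq_monotoneTransport_le (ρ : Measure ℝ) [IsProbabilityMeasure ρ] :
    ∫⁻ y, ENNReal.ofReal ((monotoneTransport ρ y - y) ^ 2) ∂stdGaussian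
      ≤ 2 * klDiv ρ stdGaussian := by
  by_cases hfin : klDiv ρ stdGaussian = ∞
  · simp [hfin]
  have hac := (klDiv_ne_top_iff.1 hfin).1
  set c : ℕ → ℝ := fun n => Real.cos (1 / ((n : ℝ) + 1))
  set s : ℕ → ℝ := fun n => Real.sin (1 / ((n : ℝ) + 1))
  have hcs : ∀ n, c n ^ 2 + s n ^ 2 = 1 := fun n => Real.cos_sq_add_sin_sq _
  have hspos : ∀ n, 0 < s n := fun n => by
    refine Real.sin_pos_of_pos_of_lt_pi (by positivity) ?_
    refine lt_of_le_of_lt ?_ (by linarith [Real.pi_gt_three] : (1 : ℝ) < Real.pi)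
    rw [div_le_one (by positivity)]
    linarith [Nat.cast_nonneg (α := ℝ) n]
  have h0 := tendsto_one_div_add_atTop_nhds_zero_nat (𝕜 := ℝ)
  have hc : Tendsto c atTop (𝓝 1) := by
    rw [← Real.cos_zero]
    exact (Real.continuous_cos.tendsto 0).comp h0
  have hs : Tendsto s atTop (𝓝 0) := by
    rw [← Real.sin_zero]
    exact (Real.continuous_sin.tendsto 0).comp h0
  set ρs : ℕ → Measure ℝ := fun n => ouSmoothing (c n) (s n) ρ
  have hcdf : ∀ x, Tendsto (fun n => cdf (ρs n) x) atTop (𝓝 (cdf ρ x)) := fun x =>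
    tendsto_cdf_ouSmoothing (hac (measure_singleton x)) hc hs
  have hae : ∀ᵐ y ∂stdGaussian, ContinuousAt (monotoneTransport ρ) y := by
    have := (monotone_monotoneTransport ρ).countable_not_continuousAt
    exact this.ae_notMem stdGaussian |>.mono fun y hy => by simpa using hy
  have hbound : ∀ n, ∫⁻ y, ENNReal.ofReal ((monotoneTransport (ρs n) y - y) ^ 2) ∂stdGaussian
      ≤ 2 * klDiv ρ stdGaussian := by
    intro n
    have hle := klDiv_ouSmoothing_le (hcs n) ρ
    refine (lintegral_sq_monotoneTransport_le_of_density
      (ouSmoothing_eq_withDensity (hspos n)) continuous_ouDensity (ouDensity_pos (hspos n))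
      (ne_top_of_le_ne_top hfin hle)).trans ?_
    gcongr
  calc ∫⁻ y, ENNReal.ofReal ((monotoneTransport ρ y - y) ^ 2) ∂stdGaussian
      = ∫⁻ y, liminf (fun n => ENNReal.ofReal ((monotoneTransport (ρs n) y - y) ^ 2)) atTop
          ∂stdGaussian := by
        refine lintegral_congr_ae ?_
        filter_upwards [hae] with y hy
        refine (Tendsto.liminf_eq ?_).symm
        exact ENNReal.tendsto_ofReal (((tendsto_monotoneTransport hcdf hy).sub_const y).pow 2)
    _ ≤ liminf (fun n => ∫⁻ y, ENNReal.ofReal ((monotoneTransport (ρs n) y - y) ^ 2)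
          ∂stdGaussian) atTop := by
        refine lintegral_liminf_le fun n => ?_
        have := (monotone_monotoneTransport (ρs n)).measurable
        fun_prop
    _ ≤ 2 * klDiv ρ stdGaussian := by
        refine liminf_le_of_frequently_le' (Frequently.of_forall hbound)

/-! ### Conditional entropy and measurable families of transport maps -/

/-- The entropy between two composition-products with the same first marginal dominates the averaged
entropy of the kernels. The majorant `g` avoids measurability questions about
`a ↦ klDiv (κ a) (η a)`. -/
lemma exists_ae_klDiv_le {α β : Type*} {_ : MeasurableSpace α} {_ : MeasurableSpace β}
    [MeasurableSpace.CountablyGenerated β] (μ : Measure α) [IsProbabilityMeasure μ]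
    (κ η : Kernel α β) [IsMarkovKernel κ] [IsMarkovKernel η] (hfin : klDiv (μ ⊗ₘ κ) (μ ⊗ₘ η) ≠ ∞) :
    ∃ g : α → ℝ≥0∞, Measurable g ∧ (∀ᵐ a ∂μ, klDiv (κ a) (η a) ≤ g a) ∧
      ∫⁻ a, g a ∂μ ≤ klDiv (μ ⊗ₘ κ) (μ ⊗ₘ η) := by
  have hac := (klDiv_ne_top_iff.1 hfin).1
  have hκ : ∀ᵐ a ∂μ, κ a ≪ η a := hac.kernel_of_compProd
  set f : α → β → ℝ≥0∞ := Kernel.rnDeriv κ η with hf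
  have hfm : Measurable (Function.uncurry f) := Kernel.measurable_rnDeriv κ η
  have hcongr : κ =ᵐ[μ] η.withDensity f := by
    filter_upwards [hκ] with a ha
    rw [Kernel.withDensity_apply _ hfm,
      withDensity_congr_ae (Kernel.rnDeriv_eq_rnDeriv_measure (κ := κ) (η := η) (a := a)),
      Measure.withDensity_rnDeriv_eq _ _ ha]
  have hwd : μ ⊗ₘ κ = (μ ⊗ₘ η).withDensity fun p => f p.1 p.2 := by
    rw [Measure.compProd_congr hcongr, Measure.compProd_withDensity hfm]
  have hrn : (μ ⊗ₘ κ).rnDeriv (μ ⊗ₘ η) =ᵐ[μ ⊗ₘ η] fun p => f p.1 p.2 := by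
    nth_rewrite 1 [hwd]
    exact Measure.rnDeriv_withDensity _ hfm
  refine ⟨fun a => ∫⁻ x, ENNReal.ofReal (klFun (f a x).toReal) ∂(η a), ?_, ?_, ?_⟩
  · exact Measurable.lintegral_kernel_prod_right' (κ := η)
      (f := fun p : α × β => ENNReal.ofReal (klFun (f p.1 p.2).toReal))
      (measurable_klFun.comp hfm.ennreal_toReal).ennreal_ofReal
  · filter_upwards [hκ] with a ha
    rw [klDiv_eq_lintegral_klFun_of_ac ha]
    refine (lintegral_congr_ae ?_).le
    filter_upwards [Kernel.rnDeriv_eq_rnDeriv_measure (κ := κ) (η := η) (a := a)] with x hx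
    rw [← hx]
  · rw [klDiv_eq_lintegral_klFun_of_ac hac, ← Measure.lintegral_compProd (κ := η)
      (f := fun p : α × β => ENNReal.ofReal (klFun (f p.1 p.2).toReal))
      (measurable_klFun.comp hfm.ennreal_toReal).ennreal_ofReal]
    refine (lintegral_congr_ae ?_).le
    filter_upwards [hrn] with p hp
    rw [hp]

lemma measurable_monotoneTransport_kernel {α : Type*} {_ : MeasurableSpace α} (κ : Kernel α ℝ)
    [IsMarkovKernel κ] : Measurable fun p : α × ℝ => monotoneTransport (κ p.1) p.2 := by
  refine measurable_of_Iic fun x => ?_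
  have : (fun p : α × ℝ => monotoneTransport (κ p.1) p.2) ⁻¹' Iic x
      = {p | cdf stdGaussian p.2 ≤ (κ p.1).real (Iic x)} := by
    ext p
    simp [monotoneTransport_le_iff, cdf_eq_real]
  rw [this]
  refine measurableSet_le ((continuous_cdf stdGaussian).measurable.comp measurable_snd) ?_
  exact ((κ.measurable_coe measurableSet_Iic).comp measurable_fst).ennreal_toReal

/-- Optimal maps onto all the measures `κ a` at once. The variance `0` is included for degenerate
coordinates, where finite entropy leaves only the Dirac mass. -/
lemma exists_transport_family {α : Type*} {_ : MeasurableSpace α} {v : ℝ≥0} (hv : v = 0 ∨ v = 1)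
    (κ : Kernel α ℝ) [IsMarkovKernel κ] :
    ∃ T : α × ℝ → ℝ, Measurable T ∧ ∀ a, klDiv (κ a) (gaussianReal 0 v) ≠ ∞ →
      (gaussianReal 0 v).map (fun y => T (a, y)) = κ a ∧
      ∫⁻ y, ENNReal.ofReal ((T (a, y) - y) ^ 2) ∂(gaussianReal 0 v)
        ≤ 2 * klDiv (κ a) (gaussianReal 0 v) := by
  rcases hv with rfl | rfl
  · refine ⟨Prod.snd, measurable_snd, fun a ha => ⟨?_, by simp⟩⟩
    have hac := (klDiv_ne_top_iff.1 ha).1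
    rw [gaussianReal_zero_var] at hac ⊢
    change (Measure.dirac 0).map id = κ a
    rw [Measure.map_id]
    have h0 : κ a {0}ᶜ = 0 := hac (by simp)
    have h1 : κ a {0} = 1 := (prob_compl_eq_zero_iff (measurableSet_singleton 0)).1 h0
    ext s hs
    rw [Measure.dirac_apply' _ hs]
    by_cases h : (0 : ℝ) ∈ s
    · rw [indicator_of_mem h, Pi.one_apply]
      exact (le_antisymm prob_le_one (h1 ▸ measure_mono (singleton_subset_iff.2 h))).symm
    · rw [indicator_of_notMem h]
      exact (measure_mono_null (by rintro x hx rfl; exact h hx) h0).symm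
  · exact ⟨_, measurable_monotoneTransport_kernel κ, fun a _ =>
      ⟨map_monotoneTransport (κ a), lintegral_sq_monotoneTransport_le (κ a)⟩⟩

lemma exists_transport_compProd {α : Type*} {_ : MeasurableSpace α} {v : ℝ≥0} (hv : v = 0 ∨ v = 1)
    (μ : Measure α) [IsProbabilityMeasure μ] (κ : Kernel α ℝ) [IsMarkovKernel κ]
    (hfin : klDiv (μ ⊗ₘ κ) (μ.prod (gaussianReal 0 v)) ≠ ∞) :
    ∃ T : α × ℝ → ℝ, Measurable T ∧
      (μ.prod (gaussianReal 0 v)).map (fun p => (p.1, T p)) = μ ⊗ₘ κ ∧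
      ∫⁻ p, ENNReal.ofReal ((T p - p.2) ^ 2) ∂(μ.prod (gaussianReal 0 v))
        ≤ 2 * klDiv (μ ⊗ₘ κ) (μ.prod (gaussianReal 0 v)) := by
  set m := gaussianReal 0 v with hm
  rw [← Measure.compProd_const] at hfin
  obtain ⟨g, hg, hκg, hint⟩ := exists_ae_klDiv_le μ κ (Kernel.const α m) hfin
  obtain ⟨T, hT, h⟩ := exists_transport_family hv κ
  have hgtop : ∀ᵐ a ∂μ, g a < ∞ := ae_lt_top hg (ne_top_of_le_ne_top hfin hint)
  have hκg' : ∀ᵐ a ∂μ, klDiv (κ a) m ≤ g a := by simpa using hκg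
  have hgood : ∀ᵐ a ∂μ, klDiv (κ a) m ≠ ∞ := by
    filter_upwards [hgtop, hκg'] with a h1 h2 using (h2.trans_lt h1).ne
  refine ⟨T, hT, ?_, ?_⟩
  · ext s hs
    rw [Measure.map_apply (by fun_prop) hs, Measure.compProd_apply hs,
      Measure.prod_apply (hs.preimage (by fun_prop))]
    refine lintegral_congr_ae ?_
    filter_upwards [hgood] with a ha
    rw [← (h a ha).1, Measure.map_apply (by fun_prop) (hs.preimage (by fun_prop))]
    rfl
  · rw [← Measure.compProd_const (μ := μ) (ν := m), Measure.lintegral_compProd (by fun_prop)]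
    calc ∫⁻ a, ∫⁻ y, ENNReal.ofReal ((T (a, y) - y) ^ 2) ∂(Kernel.const α m a) ∂μ
        ≤ ∫⁻ a, 2 * g a ∂μ := by
          refine lintegral_mono_ae ?_
          filter_upwards [hgood, hκg'] with a h1 h2
          exact (h a h1).2.trans (by gcongr)
      _ = 2 * ∫⁻ a, g a ∂μ := lintegral_const_mul _ hg
      _ ≤ _ := by gcongr

/-! ### The triangular transport map on sequences -/

/-- The sequence `x` with all entries from the `n`-th on set to zero; it records `x_0, …, x_{n-1}`. -/
def trunc (n : ℕ) (x : ℕ → ℝ) : ℕ → ℝ := fun i => if i < n then x i else 0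

@[fun_prop]
lemma measurable_trunc (n : ℕ) : Measurable (trunc n) := by
  refine measurable_pi_lambda _ fun i => ?_
  unfold trunc
  split_ifs <;> fun_prop

lemma trunc_trunc_of_le {m n : ℕ} (h : m ≤ n) (x : ℕ → ℝ) : trunc m (trunc n x) = trunc m x := by
  ext i
  simp only [trunc]
  split_ifs <;> first | rfl | omega

lemma update_trunc (n : ℕ) (x : ℕ → ℝ) :
    Function.update (trunc n x) n (x n) = trunc (n + 1) x := by
  ext i
  simp only [Function.update_apply, trunc]
  split_ifs <;> first | rfl | omega | simp_all

lemma ext_of_map_trunc {μ ν : Measure (ℕ → ℝ)} [IsFiniteMeasure μ] [IsFiniteMeasure ν]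
    (h : ∀ n, μ.map (trunc n) = ν.map (trunc n)) : μ = ν := by
  refine IsProjectiveLimit.unique (P := fun I : Finset ℕ => ν.map I.restrict) (fun I => ?_)
    fun I => rfl
  obtain ⟨n, hn⟩ : ∃ n, ∀ i ∈ I, i < n := ⟨I.sup id + 1, fun i hi =>
    Nat.lt_succ_of_le (Finset.le_sup (f := id) hi)⟩
  have hr : (I.restrict : (ℕ → ℝ) → (I → ℝ)) = I.restrict ∘ trunc n := by
    funext x i
    simp [trunc, hn i.1 i.2]
  rw [hr, ← Measure.map_map (by fun_prop) (by fun_prop), h n,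
    Measure.map_map (by fun_prop) (by fun_prop), ← hr]

section Sequence

variable (m : ℕ → Measure ℝ) [∀ n, IsProbabilityMeasure (m n)]

lemma map_trunc_prodMk_infinitePi (n : ℕ) :
    (Measure.infinitePi m).map (fun y => (trunc n y, y n))
      = ((Measure.infinitePi m).map (trunc n)).prod (m n) := by
  have hind : iIndepFun (fun i (y : ℕ → ℝ) => y i) (Measure.infinitePi m) :=
    iIndepFun_infinitePi (X := fun _ x => x) (by fun_prop)
  have h := hind.indepFun_finset (Finset.range n) {n} (by simp) (by fun_prop)
  have h2 : IndepFun (trunc n) (fun y : ℕ → ℝ => y n) (Measure.infinitePi m) := by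
    have hφ : Measurable fun (z : Finset.range n → ℝ) (i : ℕ) =>
        if hi : i ∈ Finset.range n then z ⟨i, hi⟩ else 0 := by
      refine measurable_pi_lambda _ fun i => ?_
      split_ifs <;> fun_prop
    have h3 := h.comp hφ
      (measurable_pi_apply (X := fun _ : ({n} : Finset ℕ) => ℝ) ⟨n, Finset.mem_singleton_self n⟩)
    convert h3 using 1
    · ext y i
      simp [trunc]
    · rfl
  rw [h2.map_prod_eq_prod_map_map (by fun_prop) (measurable_pi_apply n).aemeasurable,
    Measure.infinitePi_map_eval]

/-- The entropy contributed by the `n`-th coordinate, conditionally on the preceding ones. -/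
noncomputable def stepEntropy (ν : Measure (ℕ → ℝ)) (n : ℕ) : ℝ≥0∞ :=
  klDiv (ν.map fun x => (trunc n x, x n)) ((ν.map (trunc n)).prod (m n))

lemma sum_stepEntropy_le (ν : Measure (ℕ → ℝ)) [IsProbabilityMeasure ν] (n : ℕ) :
    ∑ k ∈ Finset.range n, stepEntropy m ν k
      ≤ klDiv (ν.map (trunc n)) ((Measure.infinitePi m).map (trunc n)) := by
  induction n with
  | zero => simp
  | succ n ih =>
    have : IsProbabilityMeasure (ν.map (trunc n)) :=
      Measure.isProbabilityMeasure_map (by fun_prop)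
    have : IsProbabilityMeasure ((Measure.infinitePi m).map (trunc n)) :=
      Measure.isProbabilityMeasure_map (by fun_prop)
    have hchain := klDiv_compProd_eq_add (ν.map (trunc n)) ((Measure.infinitePi m).map (trunc n))
      (condDistrib (fun x : ℕ → ℝ => x n) (trunc n) ν) (Kernel.const _ (m n))
    rw [compProd_map_condDistrib (measurable_pi_apply n).aemeasurable, Measure.compProd_const,
      Measure.compProd_const, ← map_trunc_prodMk_infinitePi] at hchain
    have hdp := klDiv_map_le (ν.map (trunc (n + 1))) ((Measure.infinitePi m).map (trunc (n + 1)))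
      (g := fun x : ℕ → ℝ => (trunc n x, x n)) (by fun_prop)
    have hcomp : (fun x : ℕ → ℝ => (trunc n x, x n)) ∘ trunc (n + 1)
        = fun x => (trunc n x, x n) := by
      funext x
      simp only [Function.comp, trunc_trunc_of_le (Nat.le_succ n)]
      simp [trunc]
    rw [Measure.map_map (by fun_prop) (by fun_prop), Measure.map_map (by fun_prop) (by fun_prop),
      hcomp, hchain] at hdp
    rw [Finset.sum_range_succ]
    exact (add_le_add_left ih _).trans hdp

lemma tsum_stepEntropy_le (ν : Measure (ℕ → ℝ)) [IsProbabilityMeasure ν] :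
    ∑' k, stepEntropy m ν k ≤ klDiv ν (Measure.infinitePi m) := by
  rw [ENNReal.tsum_eq_iSup_nat]
  exact iSup_le fun n => (sum_stepEntropy_le m ν n).trans (klDiv_map_le _ _ (by fun_prop))

/-- The first `n` entries of the triangular map built from one-dimensional maps `T`: the `n`-th
entry is `T n` of the entries already built and of `y n`. -/
def triangular (T : ℕ → (ℕ → ℝ) × ℝ → ℝ) : ℕ → (ℕ → ℝ) → ℕ → ℝ
  | 0, _ => 0
  | n + 1, y => Function.update (triangular T n y) n (T n (triangular T n y, y n))

variable {T : ℕ → (ℕ → ℝ) × ℝ → ℝ}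

lemma measurable_triangular (hT : ∀ n, Measurable (T n)) (n : ℕ) :
    Measurable (triangular T n) := by
  induction n with
  | zero => exact measurable_const
  | succ n ih =>
    refine measurable_pi_lambda _ fun i => ?_
    simp only [triangular, Function.update_apply]
    split_ifs
    · exact (hT n).comp (ih.prodMk (measurable_pi_apply n))
    · fun_prop

lemma triangular_trunc {k n : ℕ} (h : k ≤ n) (y : ℕ → ℝ) :
    triangular T k (trunc n y) = triangular T k y := by
  induction k with
  | zero => rfl
  | succ k ih =>
    simp only [triangular, ih (by omega)]
    simp [trunc, show k < n by omega]

lemma trunc_triangular (n : ℕ) (y : ℕ → ℝ) :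
    trunc n (fun k => triangular T (k + 1) y k) = triangular T n y := by
  induction n with
  | zero => ext i; simp [trunc, triangular]
  | succ n ih => rw [← update_trunc, ih]; simp [triangular]

end Sequence

/-- **Talagrand's inequality for a product of standard Gaussian measures** over `ℕ`, some factors of
which may degenerate to the Dirac mass at zero. -/
theorem exists_transport_infinitePi {v : ℕ → ℝ≥0} (hv : ∀ n, v n = 0 ∨ v n = 1)
    (ν : Measure (ℕ → ℝ)) [IsProbabilityMeasure ν]
    (hfin : klDiv ν (Measure.infinitePi fun n => gaussianReal 0 (v n)) ≠ ∞) :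
    ∃ S : (ℕ → ℝ) → (ℕ → ℝ), Measurable S ∧
      (Measure.infinitePi fun n => gaussianReal 0 (v n)).map S = ν ∧
      ∫⁻ y, ∑' n, ENNReal.ofReal ((S y n - y n) ^ 2)
          ∂(Measure.infinitePi fun n => gaussianReal 0 (v n))
        ≤ 2 * klDiv ν (Measure.infinitePi fun n => gaussianReal 0 (v n)) := by
  set m : ℕ → Measure ℝ := fun n => gaussianReal 0 (v n) with hm
  set γ := Measure.infinitePi m with hγ
  have hprob : ∀ n, IsProbabilityMeasure (ν.map (trunc n)) := fun n =>
    Measure.isProbabilityMeasure_map (by fun_prop)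
  have hsum := tsum_stepEntropy_le m ν
  have hstep : ∀ n, stepEntropy m ν n ≠ ∞ := fun n =>
    ne_top_of_le_ne_top hfin ((ENNReal.le_tsum n).trans hsum)
  have hex : ∀ n, ∃ T : (ℕ → ℝ) × ℝ → ℝ, Measurable T ∧
      ((ν.map (trunc n)).prod (m n)).map (fun p => (p.1, T p))
        = ν.map (fun x => (trunc n x, x n)) ∧
      ∫⁻ p, ENNReal.ofReal ((T p - p.2) ^ 2) ∂((ν.map (trunc n)).prod (m n))
        ≤ 2 * stepEntropy m ν n := by
    intro n
    have h := exists_transport_compProd (hv n) (ν.map (trunc n))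
      (condDistrib (fun x : ℕ → ℝ => x n) (trunc n) ν)
    rw [compProd_map_condDistrib (measurable_pi_apply n).aemeasurable] at h
    exact h (hstep n)
  choose T hT hTmap hTcost using hex
  have hsm := measurable_triangular hT
  -- the next entry of `y` is independent of the entries built so far
  have hpair : ∀ n, γ.map (fun y => (triangular T n y, y n)) = (γ.map (triangular T n)).prod (m n) := by
    intro n
    have h1 : (fun y : ℕ → ℝ => (triangular T n y, y n))
        = Prod.map (triangular T n) id ∘ fun y => (trunc n y, y n) := by
      funext y
      simp [triangular_trunc le_rfl]
    have h2 : triangular T n = triangular T n ∘ trunc n := by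
      funext y
      simp [triangular_trunc le_rfl]
    rw [h1, ← Measure.map_map ((hsm n).prodMap measurable_id) (by fun_prop),
      map_trunc_prodMk_infinitePi, ← Measure.map_prod_map _ _ (hsm n) measurable_id, Measure.map_id,
      Measure.map_map (hsm n) (by fun_prop), ← h2]
  have hlaw : ∀ n, γ.map (triangular T n) = ν.map (trunc n) := by
    intro n
    induction n with
    | zero =>
      have h0 : trunc 0 = fun _ => 0 := by ext x i; simp [trunc]
      have h1 : triangular T 0 = fun _ => 0 := rfl
      rw [h0, h1, Measure.map_const, Measure.map_const]
      simp
    | succ n ih =>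
      set U : (ℕ → ℝ) × ℝ → ℕ → ℝ := fun p => Function.update p.1 n p.2 with hU
      have hUm : Measurable U := by
        refine measurable_pi_lambda _ fun i => ?_
        simp only [hU, Function.update_apply]
        split_ifs <;> fun_prop
      have h1 : triangular T (n + 1)
          = (U ∘ fun p => (p.1, T n p)) ∘ fun y => (triangular T n y, y n) := rfl
      have h2 : trunc (n + 1) = U ∘ fun x => (trunc n x, x n) := by
        funext x
        exact (update_trunc n x).symm
      have hTn := hT n
      have hsn := hsm n
      rw [h1, ← Measure.map_map (hUm.comp (by fun_prop)) (by fun_prop), hpair, ih,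
        ← Measure.map_map hUm (by fun_prop), hTmap, h2, ← Measure.map_map hUm (by fun_prop)]
  set S : (ℕ → ℝ) → (ℕ → ℝ) := fun y n => triangular T (n + 1) y n with hS
  have hSm : Measurable S := measurable_pi_lambda _ fun n =>
    (measurable_pi_apply n).comp (hsm (n + 1))
  have hSn : ∀ y n, S y n = T n (triangular T n y, y n) := fun y n => by simp [hS, triangular]
  refine ⟨S, hSm, ?_, ?_⟩
  · have : IsProbabilityMeasure (γ.map S) := Measure.isProbabilityMeasure_map hSm.aemeasurable
    refine ext_of_map_trunc fun n => ?_
    rw [Measure.map_map (by fun_prop) hSm, ← hlaw n]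
    congr 1
    funext y
    exact trunc_triangular n y
  · have hmeas : ∀ n, Measurable fun y : ℕ → ℝ => ENNReal.ofReal ((S y n - y n) ^ 2) := fun n => by
      fun_prop
    rw [lintegral_tsum fun n => (hmeas n).aemeasurable]
    calc ∑' n, ∫⁻ y, ENNReal.ofReal ((S y n - y n) ^ 2) ∂γ
        ≤ ∑' n, 2 * stepEntropy m ν n := by
          refine ENNReal.tsum_le_tsum fun n => ?_
          refine le_trans (le_of_eq ?_) (hTcost n)
          have hTn := hT n
          have hsn := hsm n
          rw [← hlaw n, ← hpair n, lintegral_map (by fun_prop) (by fun_prop)]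
          simp only [hSn]
      _ = 2 * ∑' n, stepEntropy m ν n := ENNReal.tsum_mul_left
      _ ≤ _ := by gcongr

/-! ### Lifting couplings along a statistic -/

/-- A coupling of the image measures under `f` lifts to a coupling upstairs: draw the two points
independently from the conditional laws given their images. -/
lemma exists_coupling_of_coupling_map {X Y : Type*} [MeasurableSpace X] [StandardBorelSpace X]
    [Nonempty X] [MeasurableSpace Y] [StandardBorelSpace Y] [Nonempty Y]
    {f : X → Y} (hf : Measurable f) (ν μ : Measure X)
    [IsProbabilityMeasure ν] [IsProbabilityMeasure μ] (π : Measure (Y × Y))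
    [IsProbabilityMeasure π] (h1 : π.map Prod.fst = ν.map f) (h2 : π.map Prod.snd = μ.map f) :
    ∃ θ : Measure (X × X), θ.map Prod.fst = ν ∧ θ.map Prod.snd = μ ∧
      θ.map (Prod.map f f) = π := by
  set κ : Kernel Y X := condDistrib id f ν with hκ
  set η : Kernel Y X := condDistrib id f μ with hη
  have hκν : κ ∘ₘ (ν.map f) = ν := by
    rw [hκ, condDistrib_comp_map hf.aemeasurable aemeasurable_id, Measure.map_id]
  have hημ : η ∘ₘ (μ.map f) = μ := by
    rw [hη, condDistrib_comp_map hf.aemeasurable aemeasurable_id, Measure.map_id]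
  have hsec : ∀ (ρ : Measure X) [IsProbabilityMeasure ρ],
      (condDistrib id f ρ).map f =ᵐ[ρ.map f] Kernel.id := fun ρ _ =>
    (condDistrib_comp f aemeasurable_id hf).symm.trans (condDistrib_self f)
  refine ⟨(κ ∥ₖ η) ∘ₘ π, ?_, ?_, ?_⟩
  · ext A hA
    rw [Measure.map_apply measurable_fst hA, Measure.bind_apply (hA.preimage measurable_fst)
      (by fun_prop)]
    have hA' : ν A = ∫⁻ x, κ x A ∂(ν.map f) := by
      rw [← Measure.bind_apply hA (by fun_prop), hκν]
    rw [hA', ← h1, lintegral_map (κ.measurable_coe hA) measurable_fst]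
    refine lintegral_congr fun p => ?_
    rw [← prod_univ, Kernel.parallelComp_apply_prod]
    simp
  · ext A hA
    rw [Measure.map_apply measurable_snd hA, Measure.bind_apply (hA.preimage measurable_snd)
      (by fun_prop)]
    have hA' : μ A = ∫⁻ x, η x A ∂(μ.map f) := by
      rw [← Measure.bind_apply hA (by fun_prop), hημ]
    rw [hA', ← h2, lintegral_map (η.measurable_coe hA) measurable_snd]
    refine lintegral_congr fun p => ?_
    rw [← univ_prod, Kernel.parallelComp_apply_prod]
    simp
  · have hfst : ∀ᵐ p ∂π, (κ.map f) p.1 = Kernel.id p.1 := by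
      have := hsec ν
      rw [← h1] at this
      exact ae_of_ae_map measurable_fst.aemeasurable this
    have hsnd : ∀ᵐ p ∂π, (η.map f) p.2 = Kernel.id p.2 := by
      have := hsec μ
      rw [← h2] at this
      exact ae_of_ae_map measurable_snd.aemeasurable this
    have hff : Measurable (Prod.map f f) := hf.prodMap hf
    ext A hA
    rw [Measure.map_apply hff hA, Measure.bind_apply (hA.preimage hff) (by fun_prop),
      ← lintegral_indicator_one hA]
    refine lintegral_congr_ae ?_
    filter_upwards [hfst, hsnd] with p hp1 hp2
    rw [Kernel.map_apply _ hf, Kernel.id_apply] at hp1 hp2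
    rw [Kernel.parallelComp_apply, ← Measure.map_apply hff hA, ← Measure.map_prod_map _ _ hf hf,
      hp1, hp2, Measure.dirac_prod_dirac, Measure.dirac_apply' _ hA]

/-- **Talagrand's inequality in Gaussian coordinates.** If the coordinates `g k` are independent
standard Gaussians (or vanish) under `μ`, then `ν` and `μ` have a coupling whose quadratic cost in
these coordinates is at most twice the relative entropy. The coordinates need not separate points. -/
theorem exists_coupling_of_gaussian_coordinates {X : Type*} [MeasurableSpace X]
    [StandardBorelSpace X] {g : ℕ → X → ℝ} (hg : ∀ k, Measurable (g k)) {v : ℕ → ℝ≥0}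
    (hv : ∀ n, v n = 0 ∨ v n = 1) (μ ν : Measure X) [IsProbabilityMeasure μ]
    [IsProbabilityMeasure ν]
    (hμ : μ.map (fun x k => g k x) = Measure.infinitePi fun n => gaussianReal 0 (v n))
    (hfin : klDiv ν μ ≠ ∞) :
    ∃ π : Measure (X × X), π.map Prod.fst = ν ∧ π.map Prod.snd = μ ∧
      ∫⁻ p, ∑' k, ENNReal.ofReal ((g k p.1 - g k p.2) ^ 2) ∂π ≤ 2 * klDiv ν μ := by
  have : Nonempty X := nonempty_of_isProbabilityMeasure μ
  set f : X → ℕ → ℝ := fun x k => g k x with hf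
  have hfm : Measurable f := measurable_pi_lambda _ hg
  have : IsProbabilityMeasure (ν.map f) := Measure.isProbabilityMeasure_map hfm.aemeasurable
  have hle : klDiv (ν.map f) (μ.map f) ≤ klDiv ν μ := klDiv_map_le _ _ hfm
  have hfin' := ne_top_of_le_ne_top hfin hle
  rw [hμ] at hle hfin'
  obtain ⟨S, hS, hmap, hcost⟩ := exists_transport_infinitePi hv (ν.map f) hfin'
  set γ := Measure.infinitePi fun n => gaussianReal 0 (v n)
  have : IsProbabilityMeasure (γ.map fun y => (S y, y)) :=
    Measure.isProbabilityMeasure_map (by fun_prop)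
  obtain ⟨θ, h1, h2, h3⟩ := exists_coupling_of_coupling_map hfm ν μ (γ.map fun y => (S y, y))
    (by rw [Measure.map_map measurable_fst (by fun_prop)]; exact hmap)
    (by rw [Measure.map_map measurable_snd (by fun_prop), hμ]; exact Measure.map_id)
  refine ⟨θ, h1, h2, ?_⟩
  have hc : Measurable fun p : (ℕ → ℝ) × (ℕ → ℝ) =>
      ∑' k, ENNReal.ofReal ((p.1 k - p.2 k) ^ 2) := by
    refine Measurable.tsum fun k => ?_
    fun_prop
  calc ∫⁻ p, ∑' k, ENNReal.ofReal ((g k p.1 - g k p.2) ^ 2) ∂θ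
      = ∫⁻ p, ∑' k, ENNReal.ofReal ((p.1 k - p.2 k) ^ 2) ∂(θ.map (Prod.map f f)) := by
        rw [lintegral_map hc (hfm.prodMap hfm)]
        rfl
    _ = ∫⁻ y, ∑' n, ENNReal.ofReal ((S y n - y n) ^ 2) ∂γ := by
        rw [h3, lintegral_map hc (by fun_prop)]
    _ ≤ 2 * klDiv (ν.map f) γ := hcost
    _ ≤ 2 * klDiv ν μ := by gcongr

/-! ### Uncorrelated coordinates of a Gaussian measure -/

section Coordinates

variable {E : Type*} [TopologicalSpace E] [AddCommGroup E] [Module ℝ E] [MeasurableSpace E]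
  [BorelSpace E]
  {μ : Measure E} {ℓ : ℕ → StrongDual ℝ E} {v : ℕ → ℝ≥0}

lemma map_dual_eq_gaussianReal [IsGaussian μ] (hmean : ∀ k, ∫ x, ℓ k x ∂μ = 0)
    (hcov : ∀ i j, ∫ x, ℓ i x * ℓ j x ∂μ = if i = j then (v i : ℝ) else 0) (k : ℕ) :
    μ.map (ℓ k) = gaussianReal 0 (v k) := by
  rw [IsGaussian.map_eq_gaussianReal (ℓ k), hmean,
    variance_of_integral_eq_zero (ℓ k).continuous.measurable.aemeasurable (hmean k)]
  congr
  have := hcov k k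
  simp only [if_true, ← sq] at this
  simp [this]

lemma iIndepFun_dual [IsGaussian μ] (hmean : ∀ k, ∫ x, ℓ k x ∂μ = 0)
    (hcov : ∀ i j, ∫ x, ℓ i x * ℓ j x ∂μ = if i = j then (v i : ℝ) else 0) :
    iIndepFun (fun k x => ℓ k x) μ := by
  rw [iIndepFun_iff_finset]
  intro I
  have hI : HasGaussianLaw (fun x (k : I) => ℓ k x) μ :=
    ⟨isGaussian_map_of_measurable (L := ContinuousLinearMap.pi fun k : I => ℓ k)
      (measurable_pi_lambda _ fun k : I => (ℓ k).continuous.measurable)⟩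
  have hmem : ∀ k, MemLp (ℓ k) 2 μ := fun k => by
    have := memLp_id_gaussianReal (μ := 0) (v := v k) 2
    rw [← map_dual_eq_gaussianReal hmean hcov k] at this
    exact this.comp_of_map (ℓ k).continuous.measurable.aemeasurable
  refine hI.iIndepFun_of_covariance_eq_zero (X := fun (k : I) x => ℓ k x) fun i j hij => ?_
  have hne : (i : ℕ) ≠ j := fun h => hij (Subtype.ext h)
  rw [covariance_eq_sub (hmem i) (hmem j), hmean, hmean]
  have := hcov i j
  rw [if_neg hne] at this
  simp [this]

/-- The coordinates of `N` independent copies of a Gaussian vector. -/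
lemma map_pi_dual_eq_infinitePi [IsGaussian μ] (hmean : ∀ k, ∫ x, ℓ k x ∂μ = 0)
    (hcov : ∀ i j, ∫ x, ℓ i x * ℓ j x ∂μ = if i = j then (v i : ℝ) else 0) {N : ℕ}
    (e : ℕ ≃ Fin N × ℕ) :
    (Measure.pi fun _ : Fin N => μ).map (fun X k => ℓ (e k).2 (X (e k).1))
      = Measure.infinitePi fun k => gaussianReal 0 (v (e k).2) := by
  set P := Measure.pi fun _ : Fin N => μ
  have hℓ : ∀ k, Measurable (ℓ k) := fun k => (ℓ k).continuous.measurable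
  have hm : ∀ (i : Fin N) (j : ℕ), Measurable fun X : Fin N → E => ℓ j (X i) := fun i j =>
    (hℓ j).comp (measurable_pi_apply i)
  have heval : ∀ i : Fin N, P.map (fun X => X i) = μ := fun i =>
    (measurePreserving_eval (fun _ : Fin N => μ) i).map_eq
  have h2 : ∀ i : Fin N, iIndepFun (fun j (X : Fin N → E) => ℓ j (X i)) P := by
    intro i
    have h := iIndepFun_dual hmean hcov
    rw [iIndepFun_iff_map_fun_eq_infinitePi_map hℓ, ← heval i,
      Measure.map_map (measurable_pi_lambda _ hℓ) (measurable_pi_apply i)] at h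
    rw [iIndepFun_iff_map_fun_eq_infinitePi_map (hm i)]
    refine h.trans ?_
    congr 1
    funext j
    rw [Measure.map_map (hℓ j) (measurable_pi_apply i)]
    rfl
  have h1 : iIndepFun (fun (i : Fin N) (X : Fin N → E) (j : ℕ) => ℓ j (X i)) P :=
    iIndepFun_pi (X := fun _ x j => ℓ j x) fun i => (measurable_pi_lambda _ hℓ).aemeasurable
  have h := (iIndepFun_uncurry' hm h1 h2).precomp e.injective
  rw [iIndepFun_iff_map_fun_eq_infinitePi_map fun k => hm _ _] at h
  refine h.trans ?_
  congr 1
  funext k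
  rw [← map_dual_eq_gaussianReal hmean hcov (e k).2, ← heval (e k).1,
    Measure.map_map (hℓ _) (measurable_pi_apply _)]
  rfl

lemma map_dual_eq_infinitePi [IsGaussian μ] (hmean : ∀ k, ∫ x, ℓ k x ∂μ = 0)
    (hcov : ∀ i j, ∫ x, ℓ i x * ℓ j x ∂μ = if i = j then (v i : ℝ) else 0) :
    μ.map (fun x k => ℓ k x) = Measure.infinitePi fun k => gaussianReal 0 (v k) := by
  have h := iIndepFun_dual hmean hcov
  rw [iIndepFun_iff_map_fun_eq_infinitePi_map fun k => (ℓ k).continuous.measurable] at h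
  refine h.trans ?_
  simp_rw [map_dual_eq_gaussianReal hmean hcov]

end Coordinates

/-! ### Linear functionals dominated by a Hilbert norm -/

/-- Riesz representation of a functional that is bounded by the Hilbert norm of a linear image of its
argument; the image need not be closed or dense. -/
lemma exists_inner_eq_of_abs_le {V H : Type*} [AddCommGroup V] [Module ℝ V] [NormedAddCommGroup H]
    [InnerProductSpace ℝ H] [CompleteSpace H] (J : V →ₗ[ℝ] H) (F : V →ₗ[ℝ] ℝ) {C : ℝ}
    (hC : 0 ≤ C) (h : ∀ φ, |F φ| ≤ C * ‖J φ‖) :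
    ∃ u : H, ‖u‖ ≤ C ∧ ∀ φ, F φ = inner ℝ u (J φ) := by
  have hker : J.ker ≤ F.ker := fun φ hφ => by
    have := h φ
    rw [LinearMap.mem_ker.1 hφ, norm_zero, mul_zero] at this
    exact LinearMap.mem_ker.2 (abs_nonpos_iff.1 this)
  set f₀ : J.range →ₗ[ℝ] ℝ := J.ker.liftQ F hker ∘ₗ J.quotKerEquivRange.symm.toLinearMap
  have hf₀ : ∀ φ, f₀ ⟨J φ, φ, rfl⟩ = F φ := fun φ => by
    have : J.quotKerEquivRange.symm ⟨J φ, φ, rfl⟩ = Submodule.Quotient.mk φ := by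
      rw [LinearEquiv.symm_apply_eq]
      rfl
    simp [f₀, this]
  have hbound : ∀ x, ‖f₀ x‖ ≤ C * ‖x‖ := by
    rintro ⟨_, φ, rfl⟩
    rw [hf₀]
    exact h φ
  obtain ⟨g, hg, hgn⟩ := exists_extension_norm_eq _ (f₀.mkContinuous C hbound)
  refine ⟨(InnerProductSpace.toDual ℝ H).symm g, ?_, fun φ => ?_⟩
  · rw [LinearIsometryEquiv.norm_map, hgn]
    exact LinearMap.mkContinuous_norm_le _ hC _
  · rw [InnerProductSpace.toDual_symm_apply, ← hf₀]
    exact (hg ⟨J φ, φ, rfl⟩).symm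

end GaussianTransport

namespace TorusField

open GaussianTransport

/-! ### The negative Sobolev space is a standard Borel space -/

/-- The sequence space `ℓ²(ℤ²; ℂ)`, regarded below as a real Hilbert space. -/
abbrev FreqSeq : Type := lp (fun _ : Fin 2 → ℤ => ℂ) 2

instance : SecondCountableTopology FreqSeq := by
  suffices h : TopologicalSpace.IsSeparable (univ : Set FreqSeq) from
    have := TopologicalSpace.isSeparable_univ_iff.1 h
    UniformSpace.secondCountable_of_separable FreqSeq
  -- finite linear combinations of coordinate vectors are dense
  have h1 : TopologicalSpace.IsSeparable
      (range fun p : (Fin 2 → ℤ) × ℂ => (lp.single 2 p.1 p.2 : FreqSeq)) := by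
    have : (range fun p : (Fin 2 → ℤ) × ℂ => (lp.single 2 p.1 p.2 : FreqSeq))
        = ⋃ n, range fun z : ℂ => (lp.single 2 n z : FreqSeq) := by
      ext x
      simp
    rw [this]
    exact TopologicalSpace.IsSeparable.iUnion fun n =>
      TopologicalSpace.isSeparable_range
        (lp.isometry_single (E := fun _ : Fin 2 → ℤ => ℂ) (p := 2) n).continuous
  refine h1.span (R := ℝ) |>.closure.mono fun x _ => ?_
  refine mem_closure_of_tendsto (lp.hasSum_single (by norm_num) x) (Eventually.of_forall fun F => ?_)
  exact Submodule.sum_mem _ fun n _ => Submodule.subset_span ⟨(n, x n), rfl⟩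

instance (L s : ℝ) : SecondCountableTopology (NegSobolev L s) := by
  set S : TestSpace L s →L[ℝ] FreqSeq :=
    (sobolevSeq L s ∘ₗ (toTest L s).symm.toLinearMap).mkContinuous 1 fun φ => by
      rw [one_mul]
      exact le_rfl
  set T : FreqSeq →L[ℝ] NegSobolev L s :=
    ((ContinuousLinearMap.compL ℝ (TestSpace L s) FreqSeq ℝ).flip S).comp (innerSL ℝ)
  have hT : Function.Surjective T := by
    intro Z
    obtain ⟨u, -, hu⟩ := exists_inner_eq_of_abs_le S.toLinearMap (Z : TestSpace L s →ₗ[ℝ] ℝ)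
      (norm_nonneg Z) fun φ => Z.le_opNorm φ
    exact ⟨u, ContinuousLinearMap.ext fun φ => (hu φ).symm⟩
  have := hT.denseRange.separableSpace T.continuous
  exact UniformSpace.secondCountable_of_separable _

/-! ### Fourier series on the torus -/

lemma norm_sq_toL2 (L : ℝ) (φ : SmoothTorus L) : ‖toL2 L φ‖ ^ 2 = ∫ x in box L, φ.1 x ^ 2 := by
  rw [← real_inner_self_eq_norm_sq, L2.inner_def]
  refine integral_congr_ae ?_
  filter_upwards [(memLp_smooth L φ).coeFn_toLp] with x hx
  rw [toL2, hx]
  simp [sq]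

lemma inner_toL2 (L : ℝ) (f : L2 L) (φ : SmoothTorus L) :
    inner ℝ f (toL2 L φ) = ∫ x in box L, f x * φ.1 x := by
  rw [L2.inner_def]
  refine integral_congr_ae ?_
  filter_upwards [(memLp_smooth L φ).coeFn_toLp] with x hx
  rw [toL2, hx]
  simp [mul_comm]

/-- The plane wave `e^{i ξ·x}` at frequency `ξ = (2π/L) n`. -/
noncomputable def planeWave (L : ℝ) (n : Fin 2 → ℤ) (x : Fin 2 → ℝ) : ℂ :=
  Complex.exp (Complex.I * ((∑ i, freq L n i * x i : ℝ) : ℂ))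

lemma contDiff_planeWave (L : ℝ) (n : Fin 2 → ℤ) : ContDiff ℝ ⊤ (planeWave L n) := by
  refine ContDiff.cexp (contDiff_const.mul ?_)
  exact Complex.ofRealCLM.contDiff.comp (g := Complex.ofRealCLM)
    (f := fun x : Fin 2 → ℝ => ∑ i, freq L n i * x i) (by fun_prop)

lemma conj_planeWave_mul (L : ℝ) (n k : Fin 2 → ℤ) (x : Fin 2 → ℝ) :
    starRingEnd ℂ (planeWave L n x) * planeWave L k x = planeWave L (k - n) x := by
  rw [planeWave, planeWave, planeWave, ← Complex.exp_conj, ← Complex.exp_add]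
  congr 1
  simp [freq, map_ofNat]
  ring

lemma volume_real_box {L : ℝ} (hL : 0 < L) : volume.real (box L) = L ^ 2 := by
  rw [measureReal_def, measure_congr (box_ae_eq L), Real.volume_Icc_pi_toReal]
  · simp [sq]
  · intro i; simp; linarith

lemma integral_planeWave {L : ℝ} (hL : 0 < L) (n : Fin 2 → ℤ) :
    ∫ x in box L, planeWave L n x = if n = 0 then (L : ℂ) ^ 2 else 0 := by
  split_ifs with h
  · subst h
    have : ∀ x, planeWave L 0 x = 1 := fun x => by simp [planeWave, freq]
    simp [this, volume_real_box hL]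
  · obtain ⟨i, hi⟩ : ∃ i, n i ≠ 0 := by
      by_contra! hcon
      exact h (funext hcon)
    have hfreq : (freq L n i : ℂ) ≠ 0 := by
      rw [freq]
      have := Real.pi_pos.ne'
      have := hL.ne'
      norm_cast
      have hni : (n i : ℝ) ≠ 0 := by exact_mod_cast hi
      positivity
    have hd : ∀ x, HasFDerivAt (planeWave L n) (planeWave L n x • (Complex.I •
        Complex.ofRealCLM.comp (∑ k, freq L n k •
          ContinuousLinearMap.proj (R := ℝ) (φ := fun _ : Fin 2 => ℝ) k))) x := by
      intro x
      refine HasFDerivAt.cexp (HasFDerivAt.const_mul ?_ _)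
      refine HasFDerivAt.comp (g := Complex.ofRealCLM)
        (f := fun x : Fin 2 → ℝ => ∑ i, freq L n i * x i) x Complex.ofRealCLM.hasFDerivAt ?_
      refine HasFDerivAt.fun_sum fun k _ => ?_
      exact (ContinuousLinearMap.proj (R := ℝ) (φ := fun _ : Fin 2 => ℝ) k).hasFDerivAt.const_mul _
    have hd' : ∀ x, fderiv ℝ (planeWave L n) x (Pi.single i 1)
        = (Complex.I * freq L n i) * planeWave L n x := by
      intro x
      rw [(hd x).fderiv]
      fin_cases i <;> simp <;> ring
    have h0 := integral_partial_eq_zero hL i (planeWave L n)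
      ((contDiff_planeWave L n).of_le le_top) fun x => by
        rw [planeWave, planeWave, Complex.exp_eq_exp_iff_exists_int]
        refine ⟨n i, ?_⟩
        have : (∑ k, freq L n k * (x + Pi.single i L : Fin 2 → ℝ) k : ℝ)
            = (∑ k, freq L n k * x k) + 2 * Real.pi * n i := by
          simp only [Pi.add_apply, mul_add, Finset.sum_add_distrib, Pi.single_apply, mul_ite,
            mul_zero, Finset.sum_ite_eq', Finset.mem_univ, if_true, freq]
          field_simp
        rw [this]
        push_cast
        ring
    simp_rw [hd'] at h0
    rw [integral_const_mul] at h0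
    exact (mul_eq_zero.1 h0).resolve_left (mul_ne_zero Complex.I_ne_zero hfreq)

/-- **Bessel's inequality** for the plane waves. -/
lemma summable_and_tsum_norm_sq_fourierCoef_le {L : ℝ} (hL : 0 < L) (φ : SmoothTorus L) :
    (Summable fun n => ‖fourierCoef L φ n‖ ^ 2) ∧
      (L ^ 2)⁻¹ * ∑' n, ‖fourierCoef L φ n‖ ^ 2 ≤ ‖toL2 L φ‖ ^ 2 := by
  have hmem : ∀ f : (Fin 2 → ℝ) → ℂ, Continuous f → MemLp f 2 (volume.restrict (box L)) :=
    fun f hf => (memLp_two_iff_integrable_sq_norm hf.aestronglyMeasurable).2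
      (integrableOn_box (hf.norm.pow 2))
  have hw : ∀ n, Continuous fun x => ((L⁻¹ : ℝ) : ℂ) * planeWave L n x := fun n =>
    continuous_const.mul (contDiff_planeWave L n).continuous
  have hφ : Continuous fun x => (φ.1 x : ℂ) := Complex.continuous_ofReal.comp φ.2.1.continuous
  set w : (Fin 2 → ℤ) → Lp ℂ 2 (volume.restrict (box L)) := fun n => (hmem _ (hw n)).toLp _ with hwdef
  set F : Lp ℂ 2 (volume.restrict (box L)) := (hmem _ hφ).toLp _ with hF
  have hort : Orthonormal ℂ w := by
    rw [orthonormal_iff_ite]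
    intro n k
    rw [L2.inner_def]
    have : ∫ x in box L, inner ℂ (w n x) (w k x)
        = ∫ x in box L, ((L ^ 2)⁻¹ : ℝ) * planeWave L (k - n) x := by
      refine integral_congr_ae ?_
      filter_upwards [(hmem _ (hw n)).coeFn_toLp, (hmem _ (hw k)).coeFn_toLp] with x h1 h2
      rw [hwdef]
      simp only [h1, h2]
      rw [← conj_planeWave_mul]
      simp
      ring
    rw [this, integral_const_mul, integral_planeWave hL]
    have hL' : (L : ℂ) ≠ 0 := by exact_mod_cast hL.ne'
    by_cases h : n = k
    · subst h
      simp [hL']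
    · simp [h, sub_eq_zero, Ne.symm h]
  have hin : ∀ n, inner ℂ (w n) F = ((L⁻¹ : ℝ) : ℂ) * fourierCoef L φ n := by
    intro n
    rw [L2.inner_def, fourierCoef, ← integral_const_mul]
    refine integral_congr_ae ?_
    filter_upwards [(hmem _ (hw n)).coeFn_toLp, (hmem _ hφ).coeFn_toLp] with x h1 h2
    rw [hwdef, hF]
    simp only [h1, h2]
    simp [planeWave, ← Complex.exp_conj]
    ring
  have hnorm : ‖F‖ ^ 2 = ‖toL2 L φ‖ ^ 2 := by
    rw [norm_sq_toL2]
    have h : (inner ℂ F F : ℂ).re = ‖F‖ ^ 2 := by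
      rw [inner_self_eq_norm_sq_to_K]
      norm_cast
    rw [← h, L2.inner_def]
    have : ∫ x in box L, inner ℂ (F x) (F x) = ((∫ x in box L, φ.1 x ^ 2 : ℝ) : ℂ) := by
      rw [← integral_complex_ofReal]
      refine integral_congr_ae ?_
      filter_upwards [(hmem _ hφ).coeFn_toLp] with x h2
      rw [hF, h2]
      simp [sq, ← Complex.ofReal_mul]
    rw [this, Complex.ofReal_re]
  have hs : ∀ n, ‖(inner ℂ (w n) F : ℂ)‖ ^ 2 = (L ^ 2)⁻¹ * ‖fourierCoef L φ n‖ ^ 2 := by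
    intro n
    rw [hin, norm_mul, mul_pow, Complex.norm_real, Real.norm_eq_abs, sq_abs, inv_pow]
  refine ⟨?_, ?_⟩
  · have := hort.inner_products_summable F
    simp only [hs] at this
    exact (summable_mul_left_iff (by positivity)).1 this
  · have := hort.tsum_inner_products_le F
    simp only [hs] at this
    rwa [tsum_mul_left, hnorm] at this

/-! ### The energy norm of a distribution -/

/-- The embedding `C^∞(Λ_L) → L²(Λ_L)` as a linear map. -/
noncomputable def toL2Lin (L : ℝ) : SmoothTorus L →ₗ[ℝ] L2 L where
  toFun := toL2 L
  map_add' _ _ := rfl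
  map_smul' _ _ := rfl

lemma fourierCoef_zero (L : ℝ) (n : Fin 2 → ℤ) : fourierCoef L 0 n = 0 := by
  simp [fourierCoef]

lemma fourierCoef_finset_sum (L : ℝ) {ι : Type*} (s : Finset ι) (φ : ι → SmoothTorus L)
    (n : Fin 2 → ℤ) : fourierCoef L (∑ i ∈ s, φ i) n = ∑ i ∈ s, fourierCoef L (φ i) n := by
  classical
  induction s using Finset.induction_on with
  | empty => simp [fourierCoef_zero]
  | insert i s hi ih => rw [Finset.sum_insert hi, Finset.sum_insert hi, fourierCoef_add, ih]

/-- The operator `m φ₀ - ∂₁ φ₁ - ∂₂ φ₂`, the formal adjoint of `φ ↦ (m φ, ∇ φ)`. -/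
noncomputable def massiveDiv (L m : ℝ) : (Option (Fin 2) → SmoothTorus L) →ₗ[ℝ] SmoothTorus L :=
  m • LinearMap.proj none - ∑ i, partialDeriv L i ∘ₗ LinearMap.proj (some i)

lemma massiveDiv_apply (L m : ℝ) (φ : Option (Fin 2) → SmoothTorus L) :
    massiveDiv L m φ = m • φ none - ∑ i, partialDeriv L i (φ (some i)) := by
  simp [massiveDiv]

/-- The factorization `m² - Δ = A A*` with `A = massiveDiv` makes `A` a contraction from `L²` into
`H^{-1}_m`; on the Fourier side it is the Cauchy-Schwarz inequality against the vector `(m, -iξ)`. -/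
lemma massiveInner_massiveDiv_le {L m : ℝ} (hL : 0 < L) (hm : 0 < m)
    (φ : Option (Fin 2) → SmoothTorus L) :
    massiveInner L m (massiveDiv L m φ) (massiveDiv L m φ) ≤ ∑ o, ‖toL2 L (φ o)‖ ^ 2 := by
  have hcoef : ∀ n, fourierCoef L (massiveDiv L m φ) n
      = m * fourierCoef L (φ none) n
        - ∑ i, Complex.I * freq L n i * fourierCoef L (φ (some i)) n := by
    intro n
    rw [massiveDiv_apply, sub_eq_add_neg, fourierCoef_add, fourierCoef_smul,
      ← neg_one_smul ℝ, fourierCoef_smul, fourierCoef_finset_sum]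
    simp_rw [fourierCoef_partialDeriv hL]
    push_cast
    ring
  have hpos : ∀ n, 0 < m ^ 2 + freqSq L n := fun n => by
    have := freqSq_nonneg L n
    positivity
  have hbound : ∀ n, ‖fourierCoef L (massiveDiv L m φ) n‖ ^ 2
      ≤ (m ^ 2 + freqSq L n) * ∑ o, ‖fourierCoef L (φ o) n‖ ^ 2 := by
    intro n
    have h1 : ‖fourierCoef L (massiveDiv L m φ) n‖
        ≤ ∑ o : Option (Fin 2), (o.elim m fun i => |freq L n i|) * ‖fourierCoef L (φ o) n‖ := by
      rw [hcoef, Fintype.sum_option]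
      refine (norm_sub_le _ _).trans (add_le_add (le_of_eq ?_)
        ((norm_sum_le _ _).trans (le_of_eq ?_)))
      · simp [abs_of_pos hm]
      · simp
    refine (pow_le_pow_left₀ (norm_nonneg _) h1 2).trans ?_
    refine (Finset.sum_mul_sq_le_sq_mul_sq _ _ _).trans (le_of_eq ?_)
    congr 1
    simp [Fintype.sum_option, freqSq]
  have hS : ∀ o, Summable fun n => ‖fourierCoef L (φ o) n‖ ^ 2 := fun o =>
    (summable_and_tsum_norm_sq_fourierCoef_le hL (φ o)).1
  calc massiveInner L m (massiveDiv L m φ) (massiveDiv L m φ)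
      ≤ (L ^ 2)⁻¹ * ∑' n, ∑ o, ‖fourierCoef L (φ o) n‖ ^ 2 := by
        rw [massiveInner]
        refine mul_le_mul_of_nonneg_left ?_ (by positivity)
        refine (summable_massive L hm _ _).tsum_le_tsum (fun n => ?_) (summable_sum fun o _ => hS o)
        rw [div_le_iff₀ (hpos n), Complex.mul_conj, Complex.ofReal_re, ← Complex.sq_norm,
          mul_comm]
        exact hbound n
    _ = ∑ o, (L ^ 2)⁻¹ * ∑' n, ‖fourierCoef L (φ o) n‖ ^ 2 := by
        rw [Summable.tsum_finsetSum fun o _ => hS o, Finset.mul_sum]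
    _ ≤ _ := Finset.sum_le_sum fun o _ => (summable_and_tsum_norm_sq_fourierCoef_le hL (φ o)).2

/-- A distribution that is bounded with respect to the `H^{-1}_m` norm lies in `H^1_m`, with the
corresponding bound. -/
lemma h1NormSq_le {L m Q : ℝ} (hL : 0 < L) (hm : 0 < m) (hQ : 0 ≤ Q)
    (T : SmoothTorus L →ₗ[ℝ] ℝ) (h : ∀ φ, T φ ^ 2 ≤ Q * massiveInner L m φ φ) :
    h1NormSq m T ≤ ENNReal.ofReal Q := by
  classical
  set J : (Option (Fin 2) → SmoothTorus L) →ₗ[ℝ] PiLp 2 (fun _ : Option (Fin 2) => L2 L) :=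
    (WithLp.linearEquiv 2 ℝ (Option (Fin 2) → L2 L)).symm.toLinearMap ∘ₗ
      LinearMap.pi fun o => toL2Lin L ∘ₗ LinearMap.proj o with hJ
  have hJo : ∀ φ o, J φ o = toL2 L (φ o) := fun φ o => rfl
  have hJn : ∀ φ, ‖J φ‖ ^ 2 = ∑ o, ‖toL2 L (φ o)‖ ^ 2 := fun φ => by
    rw [PiLp.norm_sq_eq_of_L2]
    rfl
  obtain ⟨g, hgn, hg⟩ := exists_inner_eq_of_abs_le J (T ∘ₗ massiveDiv L m) (Real.sqrt_nonneg Q)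
    fun φ => by
      refine abs_le_of_sq_le_sq ?_ (by positivity)
      rw [mul_pow, Real.sq_sqrt hQ, hJn]
      exact (h _).trans (mul_le_mul_of_nonneg_left (massiveInner_massiveDiv_le hL hm φ) hQ)
  have hg' : ∀ (φ : Option (Fin 2) → SmoothTorus L),
      T (massiveDiv L m φ) = ∑ o, ∫ x in box L, g o x * (φ o).1 x := by
    intro φ
    have := hg φ
    rw [LinearMap.comp_apply, PiLp.inner_apply] at this
    simp_rw [hJo, inner_toL2] at this
    exact this
  have hsingle : ∀ (o : Option (Fin 2)) (φ : SmoothTorus L),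
      T (massiveDiv L m (Pi.single o φ)) = ∫ x in box L, g o x * φ.1 x := by
    intro o φ
    rw [hg', Finset.sum_eq_single o (fun o' _ ho' => by simp [ho']) (by simp)]
    simp
  have h0 : l2NormSq T ≤ ‖m⁻¹ • g none‖ₑ ^ 2 := by
    refine iInf₂_le (m⁻¹ • g none) fun φ => ?_
    have h1 := hsingle none φ
    have h2 : massiveDiv L m (Pi.single none φ) = m • φ := by
      rw [massiveDiv_apply]
      simp
    rw [h2, map_smul, smul_eq_mul] at h1
    have h3 : ∫ x in box L, (m⁻¹ • g none : L2 L) x * φ.1 x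
        = ∫ x in box L, m⁻¹ * (g none x * φ.1 x) := by
      refine integral_congr_ae ?_
      filter_upwards [Lp.coeFn_smul m⁻¹ (g none)] with x hx
      rw [hx]
      simp [mul_assoc]
    rw [h3, integral_const_mul, ← h1]
    field_simp
  have h1 : ∀ i, l2NormSq (distDeriv i T) ≤ ‖g (some i)‖ₑ ^ 2 := by
    intro i
    refine iInf₂_le (g (some i)) fun φ => ?_
    rw [← hsingle (some i) φ, massiveDiv_apply,
      Finset.sum_eq_single i (fun j _ hj => by simp [hj]) (by simp)]
    simp [distDeriv]
  have hen : ∀ f : L2 L, ‖f‖ₑ ^ 2 = ENNReal.ofReal (‖f‖ ^ 2) := fun f => by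
    rw [← ofReal_norm, ENNReal.ofReal_pow (norm_nonneg _)]
  calc h1NormSq m T
      ≤ ∑ i, ‖g (some i)‖ₑ ^ 2 + ENNReal.ofReal (m ^ 2) * ‖m⁻¹ • g none‖ₑ ^ 2 := by
        rw [h1NormSq]
        gcongr with i _
        exact h1 i
    _ = ENNReal.ofReal (∑ o, ‖g o‖ ^ 2) := by
        rw [Fintype.sum_option, add_comm, ENNReal.ofReal_add (by positivity) (by positivity),
          ENNReal.ofReal_sum_of_nonneg fun _ _ => by positivity]
        simp_rw [hen]
        rw [← ENNReal.ofReal_mul (by positivity), norm_smul, mul_pow, norm_inv, inv_pow,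
          Real.norm_eq_abs, sq_abs, mul_inv_cancel_left₀ (by positivity)]
    _ ≤ ENNReal.ofReal Q := by
        rw [← PiLp.norm_sq_eq_of_L2]
        refine ENNReal.ofReal_le_ofReal ?_
        calc ‖g‖ ^ 2 ≤ √Q ^ 2 := pow_le_pow_left₀ (norm_nonneg _) hgn 2
          _ = Q := Real.sq_sqrt hQ

/-! ### Gaussian coordinates for the free field -/

/-- The sequence `ξ ↦ L⁻¹ (m² + |ξ|²)^{-1/2} φ̂(ξ)`, whose `ℓ²` norm is the `H^{-1}_m` norm of `φ`. -/
noncomputable def massiveSeq (L m : ℝ) (hm : 0 < m) : SmoothTorus L →ₗ[ℝ] FreqSeq where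
  toFun φ := ⟨fun n => ((L⁻¹ * (√(m ^ 2 + freqSq L n))⁻¹ : ℝ) : ℂ) * fourierCoef L φ n, by
    refine (memℓp_gen_iff (by norm_num)).2 ?_
    refine ((summable_massive L hm φ φ).mul_left ((L⁻¹) ^ 2)).congr fun n => ?_
    have hpos : 0 ≤ m ^ 2 + freqSq L n := by have := freqSq_nonneg L n; positivity
    simp only [ENNReal.toReal_ofNat, Real.rpow_ofNat, norm_mul, Complex.norm_real, mul_pow,
      Real.norm_eq_abs, sq_abs, inv_pow, Real.sq_sqrt hpos]
    rw [Complex.mul_conj, Complex.ofReal_re, ← Complex.sq_norm]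
    ring⟩
  map_add' φ ψ := by
    ext n
    simp only [lp.coeFn_add, Pi.add_apply]
    rw [← mul_add]
    congr 1
    exact fourierCoef_add L φ ψ n
  map_smul' c φ := by
    ext n
    simp only [lp.coeFn_smul, Pi.smul_apply, RingHom.id_apply, Complex.real_smul]
    rw [mul_left_comm]
    congr 1
    exact fourierCoef_smul L c φ n

lemma massiveSeq_apply (L : ℝ) {m : ℝ} (hm : 0 < m) (φ : SmoothTorus L) (n : Fin 2 → ℤ) :
    massiveSeq L m hm φ n
      = ((L⁻¹ * (√(m ^ 2 + freqSq L n))⁻¹ : ℝ) : ℂ) * fourierCoef L φ n := rfl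

lemma inner_massiveSeq (L : ℝ) {m : ℝ} (hm : 0 < m) (φ ψ : SmoothTorus L) :
    inner ℝ (massiveSeq L m hm φ) (massiveSeq L m hm ψ) = massiveInner L m φ ψ := by
  rw [lp.inner_eq_tsum, massiveInner, ← tsum_mul_left]
  refine tsum_congr fun n => ?_
  have hpos : 0 ≤ m ^ 2 + freqSq L n := by have := freqSq_nonneg L n; positivity
  rw [massiveSeq_apply, massiveSeq_apply, Complex.inner]
  have h : (L⁻¹ * (√(m ^ 2 + freqSq L n))⁻¹) ^ 2 = (L ^ 2)⁻¹ / (m ^ 2 + freqSq L n) := by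
    rw [mul_pow, inv_pow, inv_pow, Real.sq_sqrt hpos]
    rfl
  simp only [map_mul, Complex.conj_ofReal]
  rw [show ∀ a b c : ℂ, a * b * (a * c) = a ^ 2 * (c * b) by intros; ring,
    ← Complex.ofReal_pow, Complex.re_ofReal_mul, h]
  simp only [Complex.mul_re, Complex.conj_re, Complex.conj_im]
  ring

/-- The `H^{-1}_m` norm is dominated by the `H^s` norm for `s ≥ 0`. -/
lemma norm_massiveSeq_le {L m s : ℝ} (hm : 0 < m) (hs : 0 ≤ s) (φ : SmoothTorus L) :
    ‖massiveSeq L m hm φ‖ ≤ m⁻¹ * ‖toTest L s φ‖ := by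
  have h0 : 0 ≤ m⁻¹ * ‖toTest L s φ‖ := by positivity
  refine le_of_sq_le_sq ?_ h0
  rw [← real_inner_self_eq_norm_sq, inner_massiveSeq, mul_pow, norm_sq_toTest, massiveInner,
    mul_left_comm, ← tsum_mul_left (a := m⁻¹ ^ 2)]
  refine mul_le_mul_of_nonneg_left ?_ (by positivity)
  refine (summable_massive L hm φ φ).tsum_le_tsum (fun n => ?_)
    ((summable_sobolev L s φ).mul_left _)
  have h0 := freqSq_nonneg L n
  rw [Complex.mul_conj, Complex.ofReal_re, ← Complex.sq_norm, div_eq_inv_mul, inv_pow]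
  have h1 : (m ^ 2 + freqSq L n)⁻¹ ≤ (m ^ 2)⁻¹ := by
    gcongr
    linarith
  have h2 : 1 ≤ (1 + freqSq L n) ^ s := Real.one_le_rpow (by linarith) hs
  calc (m ^ 2 + freqSq L n)⁻¹ * ‖fourierCoef L φ n‖ ^ 2
      ≤ (m ^ 2)⁻¹ * (1 * ‖fourierCoef L φ n‖ ^ 2) := by
        rw [one_mul]
        gcongr
    _ ≤ _ := by gcongr

/-- Elements of `H^{-s}` do not see the kernel of the `H^{-1}_m` norm. -/
lemma toDist_eq_zero_of_massiveSeq_eq_zero {L m s : ℝ} (hL : 0 < L) (hm : 0 < m)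
    (Z : NegSobolev L s) {φ : SmoothTorus L} (h : massiveSeq L m hm φ = 0) : toDist Z φ = 0 := by
  have hcoef : ∀ n, fourierCoef L φ n = 0 := by
    intro n
    have hn : massiveSeq L m hm φ n = 0 := by rw [h]; rfl
    rw [massiveSeq_apply, mul_eq_zero] at hn
    refine hn.resolve_left ?_
    have h0 := freqSq_nonneg L n
    have : 0 < m ^ 2 + freqSq L n := by positivity
    exact Complex.ofReal_ne_zero.2 (by positivity)
  have hnorm : ‖toTest L s φ‖ = 0 := by
    have := norm_sq_toTest L s φ
    simpa [hcoef] using this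
  have h1 := Z.le_opNorm (toTest L s φ)
  rw [hnorm, mul_zero] at h1
  exact norm_le_zero_iff.1 h1

/-- A sequence of test functions, orthonormal in `H^{-1}_m` up to zero vectors, in which the pairing
with any element of `H^{-s}` satisfies Bessel's duality bound. It comes from the Gram-Schmidt process
applied to a dense sequence; the zero vectors are those of the Gram-Schmidt process. -/
lemma exists_orthonormal_tests {L m s : ℝ} (hL : 0 < L) (hm : 0 < m) (hs : 0 ≤ s) :
    ∃ (b : ℕ → SmoothTorus L) (v : ℕ → ℝ≥0), (∀ k, v k = 0 ∨ v k = 1) ∧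
      (∀ i j, massiveInner L m (b i) (b j) = if i = j then (v i : ℝ) else 0) ∧
      ∀ Z : NegSobolev L s, ∑' k, ENNReal.ofReal (toDist Z (b k) ^ 2) ≠ ∞ →
        ∀ φ, toDist Z φ ^ 2
          ≤ (∑' k, ENNReal.ofReal (toDist Z (b k) ^ 2)).toReal * massiveInner L m φ φ := by
  set J := massiveSeq L m hm with hJ
  -- a dense sequence in the test space
  have hind : IsInducing (sobolevSeq L s ∘ₗ (toTest L s).symm.toLinearMap) := ⟨rfl⟩
  have hsc : SecondCountableTopology (TestSpace L s) := hind.secondCountableTopology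
  set d : ℕ → SmoothTorus L := fun k =>
    (toTest L s).symm (TopologicalSpace.denseSeq (TestSpace L s) k) with hd
  set u : ℕ → FreqSeq := InnerProductSpace.gramSchmidtNormed ℝ fun k => J (d k) with hu
  have hspan : Submodule.span ℝ (range u) = Submodule.span ℝ (range fun k => J (d k)) := by
    rw [hu, InnerProductSpace.span_gramSchmidtNormed_range, InnerProductSpace.span_gramSchmidt]
  have hex : ∀ k, ∃ b, J b = u k := by
    intro k
    have h1 : u k ∈ Submodule.span ℝ (range fun k => J (d k)) :=
      hspan ▸ Submodule.subset_span ⟨k, rfl⟩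
    have h2 : Submodule.span ℝ (range fun k => J (d k)) ≤ J.range :=
      Submodule.span_le.2 (by rintro _ ⟨k, rfl⟩; exact ⟨d k, rfl⟩)
    exact h2 h1
  choose b hb using hex
  have hv : ∀ k, ‖u k‖ = 0 ∨ ‖u k‖ = 1 := by
    intro k
    by_cases h : u k = 0
    · exact Or.inl (by rw [h, norm_zero])
    · exact Or.inr (InnerProductSpace.gramSchmidtNormed_unit_length' h)
  have horth : ∀ i j, inner ℝ (u i) (u j) = if i = j then ‖u i‖ else 0 := by
    intro i j
    split_ifs with hij
    · subst hij
      rw [real_inner_self_eq_norm_sq]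
      rcases hv i with h | h <;> rw [h] <;> norm_num
    · simp only [hu, InnerProductSpace.gramSchmidtNormed, inner_smul_left, inner_smul_right,
        InnerProductSpace.gramSchmidt_orthogonal ℝ _ hij, mul_zero]
  refine ⟨b, fun k => ‖u k‖₊, fun k => ?_, fun i j => ?_, fun Z hZ => ?_⟩
  · rcases hv k with h | h
    · exact Or.inl (NNReal.eq h)
    · exact Or.inr (NNReal.eq h)
  · rw [← inner_massiveSeq L hm, ← hJ, hb, hb, horth]
    rfl
  set Q := (∑' k, ENNReal.ofReal (toDist Z (b k) ^ 2)).toReal with hQ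
  have hQsum : ∀ F : Finset ℕ, ∑ k ∈ F, toDist Z (b k) ^ 2 ≤ Q := by
    intro F
    have h1 : ∑ k ∈ F, toDist Z (b k) ^ 2
        = (∑ k ∈ F, ENNReal.ofReal (toDist Z (b k) ^ 2)).toReal := by
      rw [← ENNReal.ofReal_sum_of_nonneg fun _ _ => sq_nonneg _, ENNReal.toReal_ofReal
        (Finset.sum_nonneg fun _ _ => sq_nonneg _)]
    rw [h1]
    exact ENNReal.toReal_mono hZ (ENNReal.sum_le_tsum F)
  -- the bound for the dense sequence
  have hdense : ∀ k, toDist Z (d k) ^ 2 ≤ Q * ‖J (d k)‖ ^ 2 := by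
    intro k
    have hmem : J (d k) ∈ Submodule.span ℝ (range u) := hspan ▸ Submodule.subset_span ⟨k, rfl⟩
    obtain ⟨c, hc⟩ := (Finsupp.mem_span_range_iff_exists_finsupp).1 hmem
    have hc' : ∑ i ∈ c.support, c i • u i = J (d k) := hc
    have hnorm : ‖J (d k)‖ ^ 2 = ∑ i ∈ c.support, c i ^ 2 * ‖u i‖ := by
      rw [← real_inner_self_eq_norm_sq, ← hc', sum_inner]
      refine Finset.sum_congr rfl fun i hi => ?_
      rw [inner_sum, Finset.sum_eq_single i]
      · rw [inner_smul_left, inner_smul_right, horth, if_pos rfl]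
        simp
        ring
      · intro j _ hj
        rw [inner_smul_left, inner_smul_right, horth, if_neg hj.symm]
        simp
      · intro h
        exact absurd hi h
    have hzero : ∀ i, ‖u i‖ = 0 → toDist Z (b i) = 0 := fun i hi =>
      toDist_eq_zero_of_massiveSeq_eq_zero hL hm Z (by rw [← hJ, hb, norm_eq_zero.1 hi])
    have hZd : toDist Z (d k) = ∑ i ∈ c.support, (c i * ‖u i‖) * toDist Z (b i) := by
      have h1 : toDist Z (d k - ∑ i ∈ c.support, c i • b i) = 0 := by
        refine toDist_eq_zero_of_massiveSeq_eq_zero hL hm Z ?_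
        rw [← hJ, map_sub, map_sum]
        simp_rw [map_smul, hb]
        rw [hc', sub_self]
      rw [map_sub, sub_eq_zero, map_sum] at h1
      rw [h1]
      refine Finset.sum_congr rfl fun i _ => ?_
      rw [map_smul, smul_eq_mul]
      rcases hv i with h | h
      · rw [hzero i h, mul_zero, mul_zero]
      · rw [h, mul_one]
    rw [hZd, hnorm, mul_comm]
    refine (Finset.sum_mul_sq_le_sq_mul_sq _ _ _).trans ?_
    refine mul_le_mul (le_of_eq (Finset.sum_congr rfl fun i _ => ?_)) (hQsum _)
      (Finset.sum_nonneg fun _ _ => sq_nonneg _)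
      (Finset.sum_nonneg fun _ _ => mul_nonneg (sq_nonneg _) (norm_nonneg _))
    rcases hv i with h | h <;> rw [h] <;> ring
  -- both sides are continuous in the test function
  intro φ
  rw [← inner_massiveSeq L hm, real_inner_self_eq_norm_sq, ← hJ]
  set J' : TestSpace L s →L[ℝ] FreqSeq :=
    (J ∘ₗ (toTest L s).symm.toLinearMap).mkContinuous m⁻¹ fun φ =>
      norm_massiveSeq_le hm hs ((toTest L s).symm φ)
  have hclosed : IsClosed {ψ : TestSpace L s | Z ψ ^ 2 ≤ Q * ‖J' ψ‖ ^ 2} :=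
    isClosed_le (by fun_prop) (by fun_prop)
  have huniv := hclosed.closure_subset_iff.2
    (range_subset_iff.2 hdense : range (TopologicalSpace.denseSeq (TestSpace L s)) ⊆ _)
  rw [(TopologicalSpace.denseRange_denseSeq (TestSpace L s)).closure_range] at huniv
  exact huniv (mem_univ (toTest L s φ))

/-! ### Talagrand's inequality for Gaussian fields -/

lemma transportCost_le_of_coupling {X : Type*} [MeasurableSpace X] (c : X → X → ℝ≥0∞)
    {μ ν : Measure X} {π : Measure (X × X)} (h1 : π.map Prod.fst = μ) (h2 : π.map Prod.snd = ν) :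
    transportCost c μ ν ≤ ∫⁻ p, c p.1 p.2 ∂π :=
  iInf_le_of_le π (iInf_le_of_le h1 (iInf_le _ h2))

/-- Evaluation of a distribution at a test function, as a continuous functional on `H^{-s}`. -/
noncomputable def evalTest (L s : ℝ) (φ : SmoothTorus L) : StrongDual ℝ (NegSobolev L s) :=
  ContinuousLinearMap.apply ℝ ℝ (toTest L s φ)

lemma evalTest_apply {L s : ℝ} (φ : SmoothTorus L) (Z : NegSobolev L s) :
    evalTest L s φ Z = toDist Z φ := rfl

lemma toDist_sub {L s : ℝ} (Z W : NegSobolev L s) (φ : SmoothTorus L) :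
    toDist (Z - W) φ = toDist Z φ - toDist W φ := rfl

/-- A coupling of `N`-component fields whose unnormalized `H¹_m` cost is at most twice the entropy:
the cost of each component is dominated by the sum of the squares of its own coordinates. -/
lemma exists_coupling_lintegral_h1NormSq_le {L s m : ℝ} (hL : 0 < L) (hs : 0 < s) (hm : 0 < m)
    {μ : Measure (NegSobolev L s)} (hμ : IsMassiveGFF m μ) {N : ℕ} (hN : 0 < N)
    (ρ : Measure (Fin N → NegSobolev L s)) [IsProbabilityMeasure ρ]
    (hfin : klDiv ρ (Measure.pi fun _ => μ) ≠ ∞) :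
    ∃ π : Measure ((Fin N → NegSobolev L s) × (Fin N → NegSobolev L s)),
      π.map Prod.fst = ρ ∧ π.map Prod.snd = (Measure.pi fun _ => μ) ∧
      ∫⁻ p, ∑ j, h1NormSq m (toDist (p.1 j - p.2 j)) ∂π
        ≤ 2 * klDiv ρ (Measure.pi fun _ => μ) := by
  have := hμ.gaussian
  have : Nonempty (Fin N) := ⟨⟨0, hN⟩⟩
  obtain ⟨e⟩ : Nonempty (ℕ ≃ Fin N × ℕ) := nonempty_equiv_of_countable
  obtain ⟨b, v, hv, hb, hbound⟩ := exists_orthonormal_tests (s := s) hL hm hs.le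
  have hcoord := map_pi_dual_eq_infinitePi (μ := μ) (ℓ := fun k => evalTest L s (b k)) (v := v)
    (fun k => hμ.mean_zero (b k)) (fun i j => (hμ.covariance (b i) (b j)).trans (hb i j)) e
  obtain ⟨π, h1, h2, hcost⟩ := exists_coupling_of_gaussian_coordinates
    (g := fun k (X : Fin N → NegSobolev L s) => evalTest L s (b (e k).2) (X (e k).1))
    (fun k => (evalTest L s _).continuous.measurable.comp (measurable_pi_apply _))
    (fun k => hv (e k).2) (Measure.pi fun _ => μ) ρ hcoord hfin
  refine ⟨π, h1, h2, le_trans (lintegral_mono fun p => ?_) hcost⟩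
  obtain ⟨X, Y⟩ := p
  -- regroup the coordinates by component
  rw [e.tsum_eq fun q : Fin N × ℕ => ENNReal.ofReal ((evalTest L s (b q.2) (X q.1)
    - evalTest L s (b q.2) (Y q.1)) ^ 2),
    ENNReal.tsum_prod (f := fun j k => ENNReal.ofReal ((evalTest L s (b k) (X j)
      - evalTest L s (b k) (Y j)) ^ 2)), tsum_fintype]
  refine Finset.sum_le_sum fun j _ => ?_
  simp_rw [evalTest_apply, ← toDist_sub]
  by_cases hQ : ∑' k, ENNReal.ofReal (toDist (X j - Y j) (b k) ^ 2) = ∞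
  · rw [hQ]
    exact le_top
  · exact (h1NormSq_le hL hm ENNReal.toReal_nonneg _ (hbound _ hQ)).trans ENNReal.ofReal_toReal_le

theorem wassersteinH1_le {L s m : ℝ} (hL : 0 < L) (hs : 0 < s) (hm : 0 < m)
    {μ : Measure (NegSobolev L s)} (hμ : IsMassiveGFF m μ) {N : ℕ} (hN : 0 < N)
    (ρ : Measure (Fin N → NegSobolev L s)) [IsProbabilityMeasure ρ] :
    wassersteinH1 m N ρ (Measure.pi fun _ => μ)
      ≤ ENNReal.ofReal (√(2 / N)) * klDiv ρ (Measure.pi fun _ => μ) ^ (1 / 2 : ℝ) := by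
  have hN' : (0 : ℝ) < N := by exact_mod_cast hN
  by_cases hfin : klDiv ρ (Measure.pi fun _ => μ) = ∞
  · rw [hfin, ENNReal.top_rpow_of_pos (by norm_num), ENNReal.mul_top]
    · exact le_top
    · rw [Ne, ENNReal.ofReal_eq_zero, not_le]
      positivity
  obtain ⟨π, h1, h2, hcost⟩ := exists_coupling_lintegral_h1NormSq_le hL hs hm hμ hN ρ hfin
  have hconst : (N : ℝ≥0∞)⁻¹ * 2 = ENNReal.ofReal (2 / N) := by
    rw [div_eq_inv_mul, ENNReal.ofReal_mul (by positivity), ENNReal.ofReal_inv_of_pos hN',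
      ENNReal.ofReal_natCast, ENNReal.ofReal_ofNat]
  have hW : transportCost (fun X Y => (N : ℝ≥0∞)⁻¹ * ∑ j, h1NormSq m (toDist (X j - Y j))) ρ
      (Measure.pi fun _ => μ) ≤ ENNReal.ofReal (2 / N) * klDiv ρ (Measure.pi fun _ => μ) := by
    refine (transportCost_le_of_coupling _ h1 h2).trans ?_
    rw [lintegral_const_mul' _ _ (ENNReal.inv_ne_top.2 (by exact_mod_cast hN.ne')), ← hconst,
      mul_assoc]
    exact mul_le_mul_right hcost _
  refine (ENNReal.rpow_le_rpow hW (by norm_num)).trans_eq ?_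
  rw [ENNReal.mul_rpow_of_nonneg _ _ (by norm_num),
    ENNReal.ofReal_rpow_of_nonneg (by positivity) (by norm_num), Real.sqrt_eq_rpow]

theorem transportCost_spectralNormSq_le {L s : ℝ} {Cov : L2 L →L[ℝ] L2 L}
    (hpos : ∀ f, f ≠ 0 → 0 < inner ℝ (Cov f) f) {e : ℕ → SmoothTorus L} {ev : ℕ → ℝ}
    (he : Orthonormal ℝ fun k => toL2 L (e k))
    (hev : ∀ k, Cov (toL2 L (e k)) = ev k • toL2 L (e k)) {μ : Measure (NegSobolev L s)}
    (hμ : IsCenteredGaussian μ fun φ ψ => inner ℝ (Cov (toL2 L φ)) (toL2 L ψ))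
    (ν : Measure (NegSobolev L s)) [IsProbabilityMeasure ν] :
    transportCost (fun Φ Ψ => spectralNormSq e ev (toDist (Φ - Ψ))) ν μ ≤ 2 * klDiv ν μ := by
  by_cases hfin : klDiv ν μ = ∞
  · simp [hfin]
  have := hμ.gaussian
  have hinner : ∀ i j, inner ℝ (toL2 L (e i)) (toL2 L (e j)) = if i = j then (1 : ℝ) else 0 :=
    orthonormal_iff_ite.1 he
  have hevpos : ∀ k, 0 < ev k := by
    intro k
    have := hpos (toL2 L (e k)) (he.ne_zero k)
    rwa [hev, inner_smul_left, hinner, if_pos rfl, mul_one] at this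
  -- the normalized coordinates `e_k / √λ_k` are standard Gaussians
  set ℓ : ℕ → StrongDual ℝ (NegSobolev L s) := fun k => (√(ev k))⁻¹ • evalTest L s (e k) with hℓ
  have hℓa : ∀ k Z, ℓ k Z = (√(ev k))⁻¹ * toDist Z (e k) := fun k Z => rfl
  have hmean : ∀ k, ∫ Z, ℓ k Z ∂μ = 0 := fun k => by
    simp_rw [hℓa]
    rw [integral_const_mul, hμ.mean_zero, mul_zero]
  have hcov : ∀ i j, ∫ Z, ℓ i Z * ℓ j Z ∂μ = if i = j then (((1 : ℝ≥0)) : ℝ) else 0 := by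
    intro i j
    simp_rw [hℓa, mul_mul_mul_comm _ (toDist _ (e i))]
    rw [integral_const_mul, hμ.covariance, hev, inner_smul_left, hinner]
    split_ifs with hij
    · subst hij
      have := hevpos i
      rw [← mul_inv, Real.mul_self_sqrt this.le]
      simp [this.ne']
    · simp
  obtain ⟨π, h1, h2, hcost⟩ := exists_coupling_of_gaussian_coordinates (g := fun k Z => ℓ k Z)
    (fun k => (ℓ k).continuous.measurable) (fun _ => Or.inr rfl) μ ν
    (map_dual_eq_infinitePi (v := fun _ => 1) hmean hcov) hfin
  refine (transportCost_le_of_coupling _ h1 h2).trans (le_trans (le_of_eq ?_) hcost)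
  refine lintegral_congr fun p => tsum_congr fun k => ?_
  rw [hℓa, hℓa, ← mul_sub, mul_pow, inv_pow, Real.sq_sqrt (hevpos k).le, toDist_sub,
    div_eq_inv_mul]

end TorusField

theorem mainTheorem8 (L s : ℝ) (hL : 0 < L) (hs : 0 < s) :
    -- the massive Gaussian free field with `N` components
    (∀ (m : ℝ), 0 < m →
      ∀ μ : MeasureTheory.Measure (TorusField.NegSobolev L s), TorusField.IsMassiveGFF m μ →
      ∀ (N : ℕ), 0 < N →
      ∀ ρ : MeasureTheory.Measure (Fin N → TorusField.NegSobolev L s),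
        MeasureTheory.IsProbabilityMeasure ρ →
        TorusField.wassersteinH1 m N ρ (MeasureTheory.Measure.pi fun _ => μ) ≤
          ENNReal.ofReal (Real.sqrt (2 / N)) *
            InformationTheory.klDiv ρ (MeasureTheory.Measure.pi fun _ => μ) ^ (1 / 2 : ℝ)) ∧
    -- general centered Gaussian measures on `H^{-s}`
    (∀ Cov : TorusField.L2 L →L[ℝ] TorusField.L2 L,
      IsSelfAdjoint Cov → IsCompactOperator Cov → (∀ f, f ≠ 0 → 0 < inner ℝ (Cov f) f) →
      ∀ (e : ℕ → TorusField.SmoothTorus L) (ev : ℕ → ℝ),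
        Orthonormal ℝ (fun k => TorusField.toL2 L (e k)) →
        (Submodule.span ℝ (Set.range fun k => TorusField.toL2 L (e k))).topologicalClosure = ⊤ →
        (∀ k, Cov (TorusField.toL2 L (e k)) = ev k • TorusField.toL2 L (e k)) →
      ∀ μ : MeasureTheory.Measure (TorusField.NegSobolev L s),
        TorusField.IsCenteredGaussian μ
          (fun φ ψ => inner ℝ (Cov (TorusField.toL2 L φ)) (TorusField.toL2 L ψ)) →
      ∀ ν : MeasureTheory.Measure (TorusField.NegSobolev L s),
        MeasureTheory.IsProbabilityMeasure ν →
        TorusField.transportCost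
          (fun Φ Ψ => TorusField.spectralNormSq e ev (TorusField.toDist (Φ - Ψ))) ν μ ≤
          2 * InformationTheory.klDiv ν μ) := by
  refine ⟨fun m hm μ hμ N hN ρ hρ => TorusField.wassersteinH1_le hL hs hm hμ hN ρ, ?_⟩
  intro Cov _ _ hpos e ev he _ hev μ hμ ν hν
  exact TorusField.transportCost_spectralNormSq_le hpos he hev hμ ν
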